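/- Let $k\ge 1$ and $\mathbb R^k_+=(0,\infty)^k$; write $\mathbf 1=(1,\dots,1)$, and $\mathbf x>\mathbf y$ for coordinatewise strict inequality. Let $W$ be a Gaussian white noise (Brownian random measure) on $\mathbb R$ with Lebesgue control measure on a probability space, i.e. a centred Gaussian family indexed by the Borel sets of finite Lebesgue measure with $E[W(A)W(B)]=|A\cap B|$, and let $I_k(f)=\int'_{\mathbb R^k}f(\mathbf x)\,W(dx_1)\cdots W(dx_k)$ be the $k$-fold multiple Wiener–Itô integral of $f\in L^2(\mathbb R^k)$ with respect to $W$. Let $\lambda>0$ and let $g$ be a generalized tempered Hermite kernel of degree $\alpha\in\left(-\frac{k+1}{2},-\frac k2\right)$, i.e. a nonzero measurable real function on $\mathbb R^k_+$ with - $g(c\mathbf x)=c^\alpha g(\mathbf x)$ for all $c>0$ and $\mathbf x\in\mathbb R^k_+$, and - $\int_{\mathbb R^k_+}|g(\mathbf x)g(\mathbf 1+\mathbf x)|\,e^{-2\lambda u(x_1+\dots+x_k)}\,d\mathbf x<\infty$ for every $u\ge 0$. Let $\beta\ne 0$ satisfy $$-1<-\alpha-\tfrac k2-1<\beta<-\alpha-\tfrac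 k2<\tfrac12 .$$ With $(x)_+^\beta=x^\beta$ for $x>0$ and $(x)_+^\beta=0$ for $x\le0$, put, for $\mu>0$ and $t\in\mathbb R$, $$l_t^\beta(s)=\tfrac1\beta\left[(t-s)_+^\beta-(-s)_+^\beta\right],\qquad h_t^{\mu,\beta}(\mathbf x)=\int_{\mathbb R} l_t^\beta(s)\,g(s\mathbf 1-\mathbf x)\prod_{i=1}^k e^{-\mu(s-x_i)}\,1_{\{s\mathbf 1>\mathbf x\}}\,ds,\qquad Z^{\mu,\beta}(t)=I_k\big(h_t^{\mu,\beta}\big).$$ Then for every $\mu>0$ and $t\in\mathbb R$ the process is well defined: the integral defining $h_t^{\mu,\beta}(\mathbf x)$ converges absolutely for a.e. $\mathbf x$, $h_t^{\mu,\beta}\in L^2(\mathbb R^k)$, and $I_k(h_t^{\mu,\beta})$ exists. The process $Z^{\lambda,\beta}$ has stationary increments: for every $h\in\mathbb R$, $$\{Z^{\lambda,\beta}(t+h)-Z^{\lambda,\beta}(h)\}_{t\in\mathbb R}\overset{d}{=}\{Z^{\lambda,\beta}(t)-Z^{\lambda,\beta}(0)\}_{t\in\mathbb R}.$$ Moreover,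 for every $c>0$, $$\{Z^{\lambda,\beta}(ct)\}_{t\in\mathbb R}\overset{d}{=}\{c^{\beta+1+\alpha+k/2}\,Z^{c\lambda,\beta}(t)\}_{t\in\mathbb R}.$$ Here $\overset{d}{=}$ means equality of all finite-dimensional distributions. -/

import Mathlib

open MeasureTheory ProbabilityTheory Filter Topology

noncomputable section

/-- The open positive orthant of `ℝ^k`. -/
def positiveOrthant (k : ℕ) : Set (Fin k → ℝ) := {x | ∀ i, 0 < x i}

/-- Generalized tempered Hermite kernels of degree `α` on the positive orthant of `ℝ^k`.
Only the values of `g` on the orthant matter. The parameter `u` in the tempering factor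
`exp (-2 lam u (x₁ + ⋯ + x_k))` of the last condition runs over all `u ≥ 0`. -/
structure IsTemperedHermiteKernel (k : ℕ) (α lam : ℝ) (g : (Fin k → ℝ) → ℝ) : Prop where
  measurable : Measurable ((positiveOrthant k).domRestrict g)
  nonzero : ∃ x ∈ positiveOrthant k, g x ≠ 0
  lt_degree : -((k : ℝ) + 1) / 2 < α
  degree_lt : α < -(k : ℝ) / 2
  homogeneous : ∀ c : ℝ, 0 < c → ∀ x ∈ positiveOrthant k, g (c • x) = c ^ α * g x
  integrable : ∀ u : ℝ, 0 ≤ u →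
    IntegrableOn (fun x : Fin k → ℝ => |g x * g (1 + x)| * Real.exp (-2 * lam * u * ∑ i, x i))
      (positiveOrthant k)

/-- `x ↦ (x)_+ ^ β`, equal to `x ^ β` for `x > 0` and to `0` for `x ≤ 0`. -/
def posPartPow (β x : ℝ) : ℝ := if 0 < x then x ^ β else 0

/-- `l_t^β(s) = ((t - s)_+^β - (-s)_+^β) / β`. -/
def fractionalFilter (β t s : ℝ) : ℝ :=
  1 / β * (posPartPow β (t - s) - posPartPow β (-s))

/-- The integrand `l_t^β(s) g(s𝟏 - x) ∏ᵢ exp (-lam (s - xᵢ)) 1_{s𝟏 > x}`, as a function of `s`. -/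
def filteredIntegrand {k : ℕ} (g : (Fin k → ℝ) → ℝ) (lam β t : ℝ) (x : Fin k → ℝ) (s : ℝ) : ℝ :=
  Set.indicator {r : ℝ | ∀ i, x i < r}
    (fun r => fractionalFilter β t r * g (fun i => r - x i) *
      ∏ i, Real.exp (-lam * (r - x i))) s

/-- The filtered tempered kernel `h_t^{lam, β}` on `ℝ^k`. -/
def filteredKernel {k : ℕ} (g : (Fin k → ℝ) → ℝ) (lam β t : ℝ) (x : Fin k → ℝ) : ℝ :=
  ∫ s : ℝ, filteredIntegrand g lam β t x s

/-- Borel sets of finite Lebesgue measure. -/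
abbrev FiniteBorel : Type := {A : Set ℝ // MeasurableSet A ∧ volume A < ⊤}

/-- `W` is a Brownian (Gaussian white noise) random measure on `ℝ` with Lebesgue control measure:
a centred Gaussian family indexed by the Borel sets of finite measure, with
`E[W(A) W(B)] = |A ∩ B|`. -/
structure IsWhiteNoise {Ω : Type*} [MeasurableSpace Ω] (P : Measure Ω)
    (W : FiniteBorel → Ω → ℝ) : Prop where
  isGaussian : IsGaussianProcess W P
  centered : ∀ A, ∫ ω, W A ω ∂P = 0
  covariance : ∀ A B, ∫ ω, W A ω * W B ω ∂P = volume.real (A.1 ∩ B.1)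

/-- Off-diagonal step functions on `ℝ^k`: finite linear combinations of indicators of boxes
`A₁ × ⋯ × A_k` with pairwise disjoint sides of finite measure. -/
structure OffDiagStep (k : ℕ) where
  n : ℕ
  coeff : Fin n → ℝ
  side : Fin n → Fin k → FiniteBorel
  disjoint_side : ∀ j i i', i ≠ i' → Disjoint (side j i).1 (side j i').1

/-- The function `∑ⱼ aⱼ 1_{A_{j,1} × ⋯ × A_{j,k}}`. -/
def OffDiagStep.toFun {k : ℕ} (φ : OffDiagStep k) (x : Fin k → ℝ) : ℝ :=
  ∑ j, φ.coeff j * Set.indicator (Set.univ.pi fun i => (φ.side j i).1) (fun _ => (1 : ℝ)) x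

/-- The elementary multiple integral `∑ⱼ aⱼ W(A_{j,1}) ⋯ W(A_{j,k})`. -/
def OffDiagStep.integral {k : ℕ} {Ω : Type*} (φ : OffDiagStep k) (W : FiniteBorel → Ω → ℝ)
    (ω : Ω) : ℝ :=
  ∑ j, φ.coeff j * ∏ i, W (φ.side j i) ω

/-- `X` is (a version of) the multiple Wiener–Itô integral `I_k(f)` of `f ∈ L²(ℝ^k)`: the
`L²(P)`-limit of the elementary integrals of off-diagonal step functions tending to `f`
in `L²(ℝ^k)`. -/
def IsMultipleWienerIntegral {k : ℕ} {Ω : Type*} [MeasurableSpace Ω] (P : Measure Ω)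
    (W : FiniteBorel → Ω → ℝ) (f : (Fin k → ℝ) → ℝ) (X : Ω → ℝ) : Prop :=
  MemLp f 2 volume ∧ MemLp X 2 P ∧
    ∃ φ : ℕ → OffDiagStep k,
      Tendsto (fun n => eLpNorm ((φ n).toFun - f) 2 volume) atTop (𝓝 0) ∧
      Tendsto (fun n => eLpNorm ((φ n).integral W - X) 2 P) atTop (𝓝 0)

open Classical in
/-- The multiple Wiener–Itô integral `I_k(f)`, a chosen version (and `0` when it does not exist). -/
def multipleWienerIntegral {k : ℕ} {Ω : Type*} [MeasurableSpace Ω] (P : Measure Ω)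
    (W : FiniteBorel → Ω → ℝ) (f : (Fin k → ℝ) → ℝ) : Ω → ℝ :=
  if h : ∃ X, IsMultipleWienerIntegral P W f X then h.choose else 0

/-- The tempered generalized Hermite process with filtered kernel,
`Z^{lam, β}(t) = I_k(h_t^{lam, β})`, for `t ∈ ℝ`. -/
def filteredProcess {k : ℕ} {Ω : Type*} [MeasurableSpace Ω] (P : Measure Ω)
    (W : FiniteBorel → Ω → ℝ) (g : (Fin k → ℝ) → ℝ) (lam β t : ℝ) : Ω → ℝ :=
  multipleWienerIntegral P W (filteredKernel g lam β t)

/-- Equality of all finite-dimensional distributions of two real processes indexed by `ℝ`. -/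
def EqualFDD {Ω : Type*} [MeasurableSpace Ω] (P : Measure Ω) (X Y : ℝ → Ω → ℝ) : Prop :=
  ∀ I : Finset ℝ, IdentDistrib (fun ω (t : I) => X t ω) (fun ω (t : I) => Y t ω) P P

/-- Stationary increments: for every shift `h`, the processes `X(t + h) - X(h)` and `X(t) - X(0)`
have the same finite-dimensional distributions. -/
def HasStationaryIncrements {Ω : Type*} [MeasurableSpace Ω] (P : Measure Ω)
    (X : ℝ → Ω → ℝ) : Prop :=
  ∀ h : ℝ, EqualFDD P (fun t ω => X (t + h) ω - X h ω) (fun t ω => X t ω - X 0 ω)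

end

/-!
The argument has two independent halves, one about the white noise and one about the kernel.

*Multiple integrals.* For step functions `φ` on `ℝ^k` whose boxes have pairwise disjoint sides,
Wick's formula (`IsWhiteNoise.integral_prod_mul_prod`) gives
`E[I(φ)²] = ∑_σ ∫ φ(x) φ(x ∘ σ⁻¹) dx ≤ k! ‖φ‖²`. The formula is proved by splitting all sides into
the atoms of the finite field of sets they generate; the white noise of these atoms is an
independent family, and only the pairings of equal atoms survive. Since off-diagonal step functions
are dense in `L²(ℝ^k)` (`OffDiagStep.exists_tendsto`), the multiple integral exists for every
`f ∈ L²(ℝ^k)`, is unique up to null sets, and is linear. It follows that the joint law of finitely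
many multiple integrals is determined by the kernels alone, for any white noise
(`IsMultipleWienerIntegral.identDistrib`): white noises share their finite-dimensional
distributions, hence so do the elementary integrals and their limits.

*The kernel.* By Tonelli and homogeneity, the square of the `L²` norm of `h_t` is at most
`C ∫∫ |l_t(s)| |l_t(r)| |s - r|^(2α+k) exp (-μ k |s - r|) ds dr`, where `C = ∫ |g(z) g(1 + z)| dz`
is finite by the tempering condition at `u = 0`. Young's inequality bounds this by norms
`‖l_t‖_p² ‖K‖_q` with `1/p = 1 - θ/2`, `1/q = θ`, and the restrictions on `β` are what makes room
for a `θ` for which both norms are finite (`IsTemperedHermiteKernel.lintegral_sq_lt_top`).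

*Conclusion.* For `c > 0`, the family `A ↦ c^(-1/2) W(c A + h)` is again a white noise `W'`, and
`I_k^W(f((· - h) / c)) = c^(k/2) I_k^{W'}(f)`. Stationarity of increments is the case `c = 1`, as
`h_{t+h} - h_h` is the translate of `h_t`; the scaling relation is the case `h = 0`, as the kernel
at time `c t` with tempering `λ` is `c^(β+α+1)` times the dilated kernel at time `t` with tempering
`c λ`.
-/

noncomputable section

/-! ### White noise: additivity and independent atoms -/

theorem sum_mul_mul_sum_mul {R ι κ : Type*} [CommSemiring R] [Fintype ι] [Fintype κ]
    (a : ι → R) (y : ι → R) (b : κ → R) (z : κ → R) :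
    (∑ i, a i * y i) * (∑ j, b j * z j) = ∑ i, ∑ j, a i * b j * (y i * z j) := by
  rw [Finset.sum_mul_sum]
  exact Finset.sum_congr rfl fun i _ => Finset.sum_congr rfl fun j _ => mul_mul_mul_comm _ _ _ _

section WhiteNoise

variable {Ω : Type*} [MeasurableSpace Ω] {P : Measure Ω} {W : FiniteBorel → Ω → ℝ}

theorem IsWhiteNoise.hasGaussianLaw (hW : IsWhiteNoise P W) (A : FiniteBorel) :
    HasGaussianLaw (W A) P := hW.isGaussian.hasGaussianLaw_eval A

theorem IsWhiteNoise.memLp (hW : IsWhiteNoise P W) (A : FiniteBorel) {p : ENNReal} (hp : p ≠ ⊤) :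
    MemLp (W A) p P := (hW.hasGaussianLaw A).memLp hp

theorem IsWhiteNoise.memLp_prod (hW : IsWhiteNoise P W) {ι : Type*} (s : Finset ι)
    (A : ι → FiniteBorel) {p : ENNReal} (hp : p ≠ ⊤) :
    MemLp (fun ω => ∏ i ∈ s, W (A i) ω) p P := by
  have := hW.isGaussian.isProbabilityMeasure
  rcases s.eq_empty_or_nonempty with rfl | hs
  · simpa using memLp_const (μ := P) (p := p) (1 : ℝ)
  · have h := MemLp.prod' (s := s) (f := fun i => W (A i)) (p := fun _ => p * s.card) (μ := P)
      fun i _ => hW.memLp (A i) (ENNReal.mul_ne_top hp (by simp))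
    refine h.mono_exponent ?_
    have h0 : (s.card : ENNReal) ≠ 0 := by simpa using hs.ne_empty
    rw [Finset.sum_const, nsmul_eq_mul, ENNReal.le_inv_iff_le_inv,
      ENNReal.mul_inv (Or.inr (by simp)) (Or.inr h0), mul_comm, mul_assoc,
      ENNReal.inv_mul_cancel h0 (by simp), mul_one]

theorem IsWhiteNoise.cov_eq (hW : IsWhiteNoise P W) (A B : FiniteBorel) :
    cov[W A, W B; P] = volume.real (A.1 ∩ B.1) := by
  have := hW.isGaussian.isProbabilityMeasure
  rw [covariance_eq_sub (hW.memLp A (by simp)) (hW.memLp B (by simp)), hW.centered, hW.centered]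
  simpa using hW.covariance A B

theorem FiniteBorel.integral_indicator_mul (A B : FiniteBorel) :
    ∫ x, A.1.indicator (fun _ => (1 : ℝ)) x * B.1.indicator (fun _ => (1 : ℝ)) x
      = volume.real (A.1 ∩ B.1) := by
  rw [← integral_indicator_one (A.2.1.inter B.2.1)]
  congr with x
  by_cases h1 : x ∈ A.1 <;> by_cases h2 : x ∈ B.1 <;> simp [h1, h2]

theorem FiniteBorel.integrable_indicator_mul (A B : FiniteBorel) :
    Integrable fun x => A.1.indicator (fun _ => (1 : ℝ)) x * B.1.indicator (fun _ => (1 : ℝ)) x := by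
  have h : Integrable ((A.1 ∩ B.1).indicator fun _ => (1 : ℝ)) :=
    (integrable_indicator_iff (A.2.1.inter B.2.1)).2 <|
      integrableOn_const (((measure_mono Set.inter_subset_left).trans_lt A.2.2).ne)
  refine h.congr (ae_of_all _ fun x => ?_)
  by_cases h1 : x ∈ A.1 <;> by_cases h2 : x ∈ B.1 <;> simp [h1, h2]

/-- The first-order isometry: a white noise, extended linearly to simple functions, preserves the
`L²` inner product. -/
theorem IsWhiteNoise.integral_sum_mul_sum (hW : IsWhiteNoise P W) {ι κ : Type*} [Fintype ι]
    [Fintype κ] (a : ι → ℝ) (A : ι → FiniteBorel) (b : κ → ℝ) (B : κ → FiniteBorel) :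
    ∫ ω, (∑ i, a i * W (A i) ω) * (∑ j, b j * W (B j) ω) ∂P
      = ∫ x, (∑ i, a i * (A i).1.indicator (fun _ => (1 : ℝ)) x)
          * (∑ j, b j * (B j).1.indicator (fun _ => (1 : ℝ)) x) := by
  have hint : ∀ i j, Integrable (fun ω => W (A i) ω * W (B j) ω) P := fun i j =>
    (hW.memLp (A i) (p := 2) (by simp)).integrable_mul (hW.memLp (B j) (p := 2) (by simp))
  simp_rw [sum_mul_mul_sum_mul]
  rw [integral_finsetSum _ fun i _ => integrable_finsetSum _ fun j _ => (hint i j).const_mul _,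
    integral_finsetSum _ fun i _ => integrable_finsetSum _ fun j _ =>
      (FiniteBorel.integrable_indicator_mul _ _).const_mul _]
  refine Finset.sum_congr rfl fun i _ => ?_
  rw [integral_finsetSum _ fun j _ => (hint i j).const_mul _,
    integral_finsetSum _ fun j _ => (FiniteBorel.integrable_indicator_mul _ _).const_mul _]
  refine Finset.sum_congr rfl fun j _ => ?_
  rw [integral_const_mul, integral_const_mul, hW.covariance, FiniteBorel.integral_indicator_mul]

/-- A white noise is almost surely additive: a linear relation between indicator functions is
inherited by the corresponding Gaussian variables. -/
theorem IsWhiteNoise.ae_eq_sum (hW : IsWhiteNoise P W) {ι : Type*} [Fintype ι]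
    (S : FiniteBorel) (a : ι → ℝ) (A : ι → FiniteBorel)
    (h : ∀ x, S.1.indicator (fun _ => (1 : ℝ)) x
      = ∑ i, a i * (A i).1.indicator (fun _ => (1 : ℝ)) x) :
    W S =ᵐ[P] fun ω => ∑ i, a i * W (A i) ω := by
  let a' : Option ι → ℝ := fun o => o.elim 1 fun i => -a i
  let A' : Option ι → FiniteBorel := fun o => o.elim S A
  have h0 : ∫ ω, (∑ i, a' i * W (A' i) ω) * (∑ i, a' i * W (A' i) ω) ∂P = 0 := by
    rw [hW.integral_sum_mul_sum]
    simp [a', A', Fintype.sum_option, h]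
  have hmem : MemLp (fun ω => ∑ i, a' i * W (A' i) ω) 2 P :=
    memLp_finsetSum _ fun i _ => (hW.memLp (A' i) (by simp)).const_mul _
  rw [integral_eq_zero_iff_of_nonneg (fun ω => mul_self_nonneg _) (hmem.integrable_mul hmem)] at h0
  filter_upwards [h0] with ω hω
  have := mul_self_eq_zero.1 hω
  simp only [a', A', Fintype.sum_option, Option.elim_none, Option.elim_some, one_mul, neg_mul,
    Finset.sum_neg_distrib] at this
  linarith

/-- The atom of the field of sets generated by the family `S` that lies in `S m` exactly for
`m ∈ b`. The atom of `b = ∅`, of infinite measure, is replaced by the empty set. -/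
def FiniteBorel.atom {ι : Type*} [Finite ι] (S : ι → FiniteBorel) (b : Finset ι) : FiniteBorel :=
  ⟨{x | b.Nonempty ∧ ∀ m, x ∈ (S m).1 ↔ m ∈ b}, by
    refine ⟨?_, ?_⟩
    · refine MeasurableSet.inter (MeasurableSet.const _) ?_
      have := Finite.to_countable (α := ι)
      have hset : {x | ∀ m, x ∈ (S m).1 ↔ m ∈ b} = ⋂ m, {x | x ∈ (S m).1 ↔ m ∈ b} := by
        ext; simp
      refine (congrArg MeasurableSet hset).mpr (MeasurableSet.iInter fun m => ?_)
      by_cases hm : m ∈ b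
      · simpa [hm] using (S m).2.1
      · have h := (S m).2.1.compl
        convert! h using 1
        ext x; simp [hm]
    · rcases b.eq_empty_or_nonempty with rfl | ⟨m, hm⟩
      · simp
      · exact (measure_mono fun x hx => (hx.2 m).2 hm).trans_lt (S m).2.2⟩

theorem FiniteBorel.disjoint_atom {ι : Type*} [Finite ι] (S : ι → FiniteBorel) {b b' : Finset ι}
    (h : b ≠ b') : Disjoint (FiniteBorel.atom S b).1 (FiniteBorel.atom S b').1 := by
  refine Set.disjoint_left.2 fun x hx hx' => h ?_
  ext m
  rw [← hx.2 m, hx'.2 m]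

/-- A member of the family is the disjoint union of the atoms which it contains; any weight `u`
which is `1` on the index `{m | x ∈ S m}` of a point of `S i`, and `0` on the index of a point
outside `S i`, picks out these atoms. -/
theorem FiniteBorel.indicator_eq_sum_atom {ι : Type*} [Fintype ι] [DecidableEq ι]
    (S : ι → FiniteBorel) (i : ι) (u : Finset ι → ℝ)
    (h1 : ∀ x ∈ (S i).1, ∀ b : Finset ι, (∀ m, x ∈ (S m).1 ↔ m ∈ b) → u b = 1)
    (h0 : ∀ b, i ∉ b → u b = 0) (x : ℝ) :
    (S i).1.indicator (fun _ => (1 : ℝ)) x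
      = ∑ b, u b * (FiniteBorel.atom S b).1.indicator (fun _ => (1 : ℝ)) x := by
  classical
  by_cases hx : x ∈ (S i).1
  · let b₀ : Finset ι := Finset.univ.filter fun m => x ∈ (S m).1
    have hb₀ : ∀ m, x ∈ (S m).1 ↔ m ∈ b₀ := by simp [b₀]
    have hmem : x ∈ (FiniteBorel.atom S b₀).1 := ⟨⟨i, (hb₀ i).1 hx⟩, hb₀⟩
    rw [Finset.sum_eq_single b₀]
    · simp [hx, hmem, h1 x hx b₀ hb₀]
    · intro b _ hb
      have : x ∉ (FiniteBorel.atom S b).1 :=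
        Set.disjoint_left.1 (FiniteBorel.disjoint_atom S hb.symm) hmem
      simp [this]
    · simp
  · rw [Set.indicator_of_notMem hx, Finset.sum_eq_zero]
    intro b _
    by_cases hb : i ∈ b
    · have : x ∉ (FiniteBorel.atom S b).1 := fun h => hx ((h.2 i).2 hb)
      simp [this]
    · simp [h0 b hb]

end WhiteNoise

/-- Mixed moments of two off-diagonal monomials in independent centred variables: only pairings
of the factors of the first monomial with those of the second contribute. -/
theorem ProbabilityTheory.iIndepFun.integral_prod_mul_prod_of_injective {Ω ι : Type*}
    [MeasurableSpace Ω]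
    {P : Measure Ω} [Fintype ι] [DecidableEq ι] {k : ℕ} {X : ι → Ω → ℝ} (hX : iIndepFun X P)
    (hm : ∀ b, AEMeasurable (X b) P) (h0 : ∀ b, ∫ ω, X b ω ∂P = 0)
    {c d : Fin k → ι} (hc : Function.Injective c) (hd : Function.Injective d) :
    ∫ ω, (∏ i, X (c i) ω) * ∏ i, X (d i) ω ∂P
      = ∑ σ : Equiv.Perm (Fin k), ∏ i,
          if c i = d (σ i) then ∫ ω, X (c i) ω * X (c i) ω ∂P else 0 := by
  classical
  have := hX.isProbabilityMeasure
  have hprod : ∀ (e : Fin k → ι), Function.Injective e → ∀ y : ι → ℝ,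
      ∏ i, y (e i) = ∏ b, if b ∈ Set.range e then y b else 1 := by
    intro e he y
    rw [← Finset.prod_image (s := Finset.univ) (g := e) (f := y) (fun i _ j _ h => he h),
      ← Finset.prod_filter]
    congr 1
    ext b; simp
  let f : ι → ℝ → ℝ := fun b x =>
    (if b ∈ Set.range c then x else 1) * (if b ∈ Set.range d then x else 1)
  have hf : ∀ b, Measurable (f b) := by
    intro b
    simp only [f]
    split_ifs <;> fun_prop
  have hL : ∫ ω, (∏ i, X (c i) ω) * ∏ i, X (d i) ω ∂P = ∏ b, ∫ ω, f b (X b ω) ∂P := by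
    rw [← hX.integral_fun_prod_comp hm fun b => (hf b).aestronglyMeasurable]
    congr with ω
    rw [hprod c hc fun b => X b ω, hprod d hd fun b => X b ω, ← Finset.prod_mul_distrib]
  rw [hL]
  by_cases hr : Set.range c = Set.range d
  · -- the ranges agree, so exactly one pairing matches the two monomials
    have hex : ∀ i, ∃ j, d j = c i := fun i => by
      have : c i ∈ Set.range d := hr ▸ Set.mem_range_self i
      exact this
    choose τ hτ using hex
    have hτi : Function.Injective τ := fun i j h => hc (by rw [← hτ i, ← hτ j, h])
    let σ₀ : Equiv.Perm (Fin k) := Equiv.ofBijective τ (Finite.injective_iff_bijective.1 hτi)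
    rw [Finset.sum_eq_single σ₀]
    · have h1 : ∀ i, (if c i = d (σ₀ i) then ∫ ω, X (c i) ω * X (c i) ω ∂P else 0)
          = (fun b => ∫ ω, X b ω * X b ω ∂P) (c i) := by
        intro i
        have : c i = d (σ₀ i) := (hτ i).symm
        simp only [← this, if_true]
      rw [Finset.prod_congr rfl fun i _ => h1 i, hprod c hc fun b => ∫ ω, X b ω * X b ω ∂P]
      refine Finset.prod_congr rfl fun b _ => ?_
      simp only [f, ← hr]
      split_ifs <;> simp
    · intro σ _ hσ
      by_contra hne
      refine hσ (Equiv.ext fun i => hd ?_)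
      rw [← ne_eq, Finset.prod_ne_zero_iff] at hne
      have := hne i (Finset.mem_univ i)
      have h2 : c i = d (σ i) := by by_contra h; exact this (if_neg h)
      rw [← h2]; exact (hτ i).symm
    · simp
  · -- some variable occurs exactly once, and it is centred
    have hb : ∃ b, ¬ (b ∈ Set.range c ↔ b ∈ Set.range d) := by
      by_contra h
      push Not at h
      exact hr (Set.ext h)
    obtain ⟨b, hb⟩ := hb
    rw [Finset.prod_eq_zero (Finset.mem_univ b), Finset.sum_eq_zero]
    · intro σ _
      by_contra hne
      rw [← ne_eq, Finset.prod_ne_zero_iff] at hne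
      have h2 : ∀ i, c i = d (σ i) := fun i => by
        by_contra h; exact hne i (Finset.mem_univ i) (if_neg h)
      refine hr ?_
      rw [show c = d ∘ σ from funext h2, σ.surjective.range_comp]
    · simp only [f]
      by_cases h1 : b ∈ Set.range c <;> by_cases h2 : b ∈ Set.range d
      · exact absurd (iff_of_true h1 h2) hb
      · simp [h1, h2, h0]
      · simp [h1, h2, h0]
      · exact absurd (iff_of_false h1 h2) hb

/-! ### Wick's formula -/

section SecondMoment

variable {Ω : Type*} [MeasurableSpace Ω] {P : Measure Ω} {W : FiniteBorel → Ω → ℝ}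

/-- **Wick's formula** for two off-diagonal monomials in a white noise. -/
theorem IsWhiteNoise.integral_prod_mul_prod (hW : IsWhiteNoise P W) {k : ℕ}
    (A B : Fin k → FiniteBorel) (hA : ∀ i i', i ≠ i' → Disjoint (A i).1 (A i').1)
    (hB : ∀ i i', i ≠ i' → Disjoint (B i).1 (B i').1) :
    ∫ ω, (∏ i, W (A i) ω) * ∏ i, W (B i) ω ∂P
      = ∑ σ : Equiv.Perm (Fin k), ∏ i, volume.real ((A i).1 ∩ (B (σ i)).1) := by
  classical
  have := hW.isGaussian.isProbabilityMeasure
  let S : Fin k ⊕ Fin k → FiniteBorel := Sum.elim A B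
  let C := FiniteBorel.atom S
  -- weights selecting the atoms of `A i` (of `B i`); they vanish on the atoms, empty by
  -- disjointness, which would lie in two of the sets `A i` (or `B i`)
  let u : Fin k → Finset (Fin k ⊕ Fin k) → ℝ := fun i b =>
    if ∀ j, Sum.inl j ∈ b ↔ j = i then 1 else 0
  let w : Fin k → Finset (Fin k ⊕ Fin k) → ℝ := fun i b =>
    if ∀ j, Sum.inr j ∈ b ↔ j = i then 1 else 0
  have hu : ∀ i x, (A i).1.indicator (fun _ => (1 : ℝ)) x
      = ∑ b, u i b * (C b).1.indicator (fun _ => (1 : ℝ)) x := by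
    intro i x
    refine FiniteBorel.indicator_eq_sum_atom S (Sum.inl i) (u i) (fun x hx b hb => if_pos ?_)
      (fun b hb => if_neg fun h => hb ((h i).2 rfl)) x
    intro j
    rw [← hb]
    refine ⟨fun hj => ?_, fun h => h ▸ hx⟩
    by_contra hne
    exact Set.disjoint_left.1 (hA j i hne) hj hx
  have hw : ∀ i x, (B i).1.indicator (fun _ => (1 : ℝ)) x
      = ∑ b, w i b * (C b).1.indicator (fun _ => (1 : ℝ)) x := by
    intro i x
    refine FiniteBorel.indicator_eq_sum_atom S (Sum.inr i) (w i) (fun x hx b hb => if_pos ?_)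
      (fun b hb => if_neg fun h => hb ((h i).2 rfl)) x
    intro j
    rw [← hb]
    refine ⟨fun hj => ?_, fun h => h ▸ hx⟩
    by_contra hne
    exact Set.disjoint_left.1 (hB j i hne) hj hx
  let v : Finset (Fin k ⊕ Fin k) → ℝ := fun b => volume.real (C b).1
  have hC : ∀ b b', volume.real ((C b).1 ∩ (C b').1) = if b = b' then v b else 0 := by
    intro b b'
    split_ifs with h
    · simp [← h, v]
    · simp [(FiniteBorel.disjoint_atom S h).inter_eq, C]
  -- expansion of the two monomials over the atoms
  have hexp : ∀ (D : Fin k → FiniteBorel) (r : Fin k → Finset (Fin k ⊕ Fin k) → ℝ),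
      (∀ i x, (D i).1.indicator (fun _ => (1 : ℝ)) x
        = ∑ b, r i b * (C b).1.indicator (fun _ => (1 : ℝ)) x) →
      (fun ω => ∏ i, W (D i) ω) =ᵐ[P]
        fun ω => ∑ c : Fin k → Finset (Fin k ⊕ Fin k), (∏ i, r i (c i)) * ∏ i, W (C (c i)) ω := by
    intro D r hr
    have : ∀ᵐ ω ∂P, ∀ i, W (D i) ω = ∑ b, r i b * W (C b) ω :=
      ae_all_iff.2 fun i => hW.ae_eq_sum (D i) (r i) C (hr i)
    filter_upwards [this] with ω hω
    simp_rw [hω, Finset.prod_univ_sum, Fintype.piFinset_univ, Finset.prod_mul_distrib]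
  have hinj : ∀ c : Fin k → Finset (Fin k ⊕ Fin k), ∏ i, u i (c i) ≠ 0 → Function.Injective c := by
    intro c hc i j hij
    rw [Finset.prod_ne_zero_iff] at hc
    have h1 : ∀ l, Sum.inl l ∈ c i ↔ l = i := by
      by_contra h; exact hc i (Finset.mem_univ _) (if_neg h)
    have h2 : ∀ l, Sum.inl l ∈ c j ↔ l = j := by
      by_contra h; exact hc j (Finset.mem_univ _) (if_neg h)
    exact (h2 i).1 (hij ▸ (h1 i).2 rfl)
  have hinj' : ∀ c : Fin k → Finset (Fin k ⊕ Fin k), ∏ i, w i (c i) ≠ 0 → Function.Injective c := by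
    intro c hc i j hij
    rw [Finset.prod_ne_zero_iff] at hc
    have h1 : ∀ l, Sum.inr l ∈ c i ↔ l = i := by
      by_contra h; exact hc i (Finset.mem_univ _) (if_neg h)
    have h2 : ∀ l, Sum.inr l ∈ c j ↔ l = j := by
      by_contra h; exact hc j (Finset.mem_univ _) (if_neg h)
    exact (h2 i).1 (hij ▸ (h1 i).2 rfl)
  have hindep : iIndepFun (fun b => W (C b)) P := by
    have h1 : IsGaussianProcess (fun (p : (_ : Finset (Fin k ⊕ Fin k)) × Unit) => W (C p.1)) P :=
      hW.isGaussian.comp_right fun p : (_ : Finset (Fin k ⊕ Fin k)) × Unit => C p.1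
    have h2 := h1.iIndepFun_of_covariance_eq_zero (X := fun b _ => W (C b))
      (fun b _ => (hW.hasGaussianLaw _).aemeasurable)
      (fun b b' hb _ _ => by rw [hW.cov_eq, hC, if_neg hb])
    exact h2.comp (fun _ y => y ()) fun _ => measurable_pi_apply ()
  have hmom : ∀ c d : Fin k → Finset (Fin k ⊕ Fin k),
      (∏ i, u i (c i)) * (∏ i, w i (d i)) *
        ∫ ω, (∏ i, W (C (c i)) ω) * ∏ i, W (C (d i)) ω ∂P
      = ∑ σ : Equiv.Perm (Fin k), ∏ i, u i (c i) * w (σ i) (d (σ i)) *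
          volume.real ((C (c i)).1 ∩ (C (d (σ i))).1) := by
    intro c d
    simp_rw [Finset.prod_mul_distrib, Equiv.prod_comp _ fun i => w i (d i), ← Finset.mul_sum]
    by_cases h1 : ∏ i, u i (c i) = 0
    · simp [h1]
    by_cases h2 : ∏ i, w i (d i) = 0
    · simp [h2]
    rw [hindep.integral_prod_mul_prod_of_injective
      (fun b => (hW.hasGaussianLaw _).aemeasurable) (fun b => hW.centered _)
      (hinj c h1) (hinj' d h2)]
    congr 1
    refine Finset.sum_congr rfl fun σ _ => Finset.prod_congr rfl fun i _ => ?_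
    rw [hW.covariance, hC, hC, if_pos rfl]
  have hint : ∀ c d : Fin k → Finset (Fin k ⊕ Fin k),
      Integrable (fun ω => (∏ i, W (C (c i)) ω) * ∏ i, W (C (d i)) ω) P := fun c d =>
    (hW.memLp_prod _ _ (p := 2) (by simp)).integrable_mul (hW.memLp_prod _ _ (p := 2) (by simp))
  have hinter : ∀ i j, volume.real ((A i).1 ∩ (B j).1)
      = ∑ b, ∑ b', u i b * w j b' * volume.real ((C b).1 ∩ (C b').1) := by
    intro i j
    rw [← FiniteBorel.integral_indicator_mul]
    simp_rw [hu, hw, sum_mul_mul_sum_mul]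
    rw [integral_finsetSum _ fun b _ => integrable_finsetSum _ fun b' _ =>
      (FiniteBorel.integrable_indicator_mul _ _).const_mul _]
    refine Finset.sum_congr rfl fun b _ => ?_
    rw [integral_finsetSum _ fun b' _ =>
      (FiniteBorel.integrable_indicator_mul _ _).const_mul _]
    refine Finset.sum_congr rfl fun b' _ => ?_
    rw [integral_const_mul, FiniteBorel.integral_indicator_mul]
  calc ∫ ω, (∏ i, W (A i) ω) * ∏ i, W (B i) ω ∂P
      = ∫ ω, ∑ c : Fin k → Finset (Fin k ⊕ Fin k), ∑ d : Fin k → Finset (Fin k ⊕ Fin k),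
          (∏ i, u i (c i)) * (∏ i, w i (d i)) *
          ((∏ i, W (C (c i)) ω) * ∏ i, W (C (d i)) ω) ∂P := by
        refine integral_congr_ae ?_
        filter_upwards [hexp A u hu, hexp B w hw] with ω h1 h2
        rw [h1, h2, sum_mul_mul_sum_mul]
    _ = ∑ c : Fin k → Finset (Fin k ⊕ Fin k), ∑ d : Fin k → Finset (Fin k ⊕ Fin k),
          ∑ σ : Equiv.Perm (Fin k), ∏ i, u i (c i) * w (σ i) (d (σ i)) *
          volume.real ((C (c i)).1 ∩ (C (d (σ i))).1) := by
        rw [integral_finsetSum _ fun c _ => integrable_finsetSum _ fun d _ =>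
          (hint c d).const_mul _]
        refine Finset.sum_congr rfl fun c _ => ?_
        rw [integral_finsetSum _ fun d _ => (hint c d).const_mul _]
        refine Finset.sum_congr rfl fun d _ => ?_
        rw [integral_const_mul, hmom]
    _ = ∑ σ : Equiv.Perm (Fin k), ∑ c : Fin k → Finset (Fin k ⊕ Fin k),
          ∑ d : Fin k → Finset (Fin k ⊕ Fin k), ∏ i, u i (c i) * w (σ i) (d (σ i)) *
          volume.real ((C (c i)).1 ∩ (C (d (σ i))).1) := by
        symm
        rw [Finset.sum_comm]
        exact Finset.sum_congr rfl fun c _ => Finset.sum_comm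
    _ = ∑ σ : Equiv.Perm (Fin k), ∏ i, volume.real ((A i).1 ∩ (B (σ i)).1) := by
        refine Finset.sum_congr rfl fun σ _ => ?_
        simp_rw [hinter, Finset.prod_univ_sum, Fintype.piFinset_univ]
        refine Finset.sum_congr rfl fun c _ => ?_
        exact Equiv.sum_comp (σ.arrowCongr (Equiv.refl _)).symm fun d =>
          ∏ i, u i (c i) * w (σ i) (d i) * volume.real ((C (c i)).1 ∩ (C (d i)).1)

end SecondMoment

/-! ### Elementary integrals of off-diagonal step functions -/

theorem MeasureTheory.MemLp.eLpNorm_two_eq_ofReal_sqrt {α : Type*} [MeasurableSpace α]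
    {μ : Measure α} {f : α → ℝ} (hf : MemLp f 2 μ) :
    eLpNorm f 2 μ = ENNReal.ofReal (√(∫ x, f x ^ 2 ∂μ)) := by
  rw [hf.eLpNorm_eq_integral_rpow_norm (by simp) (by simp), Real.sqrt_eq_rpow]
  simp

namespace OffDiagStep

variable {k : ℕ}

/-- The step function `c • φ + ψ`. -/
def smulAdd (c : ℝ) (φ ψ : OffDiagStep k) : OffDiagStep k where
  n := φ.n + ψ.n
  coeff := Fin.append (fun j => c * φ.coeff j) ψ.coeff
  side := Fin.append φ.side ψ.side
  disjoint_side j := by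
    refine Fin.addCases (fun j => ?_) (fun j => ?_) j
    · simpa using φ.disjoint_side j
    · simpa using ψ.disjoint_side j

theorem toFun_smulAdd (c : ℝ) (φ ψ : OffDiagStep k) :
    (smulAdd c φ ψ).toFun = c • φ.toFun + ψ.toFun := by
  ext x
  change ∑ j : Fin (φ.n + ψ.n), _ = _
  rw [Fin.sum_univ_add]
  simp [toFun, smulAdd, Finset.mul_sum, mul_assoc]

theorem integral_smulAdd {Ω : Type*} (W : FiniteBorel → Ω → ℝ) (c : ℝ) (φ ψ : OffDiagStep k) :
    (smulAdd c φ ψ).integral W = c • φ.integral W + ψ.integral W := by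
  ext x
  change ∑ j : Fin (φ.n + ψ.n), _ = _
  rw [Fin.sum_univ_add]
  simp [integral, smulAdd, Finset.mul_sum, mul_assoc]

theorem measurableSet_box (A : Fin k → FiniteBorel) :
    MeasurableSet (Set.univ.pi fun i => (A i).1) :=
  MeasurableSet.univ_pi fun i => (A i).2.1

theorem volume_box_lt_top (A : Fin k → FiniteBorel) :
    volume (Set.univ.pi fun i => (A i).1) < ⊤ := by
  rw [volume_pi_pi]
  exact ENNReal.prod_lt_top fun i _ => (A i).2.2

theorem memLp_toFun (φ : OffDiagStep k) (p : ENNReal) : MemLp φ.toFun p volume :=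
  memLp_finsetSum _ fun _ _ => MemLp.const_mul
    (memLp_indicator_const p (measurableSet_box _) 1 (Or.inr (volume_box_lt_top _).ne)) _

theorem indicator_box (A : Fin k → FiniteBorel) (x : Fin k → ℝ) :
    Set.indicator (Set.univ.pi fun i => (A i).1) (fun _ => (1 : ℝ)) x
      = ∏ i, (A i).1.indicator (fun _ => (1 : ℝ)) (x i) := by
  classical
  simp only [Set.indicator_apply, Set.mem_univ_pi]
  rw [Finset.prod_ite_zero]
  simp

variable {Ω : Type*} [MeasurableSpace Ω] {P : Measure Ω} {W : FiniteBorel → Ω → ℝ}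

theorem memLp_integral (hW : IsWhiteNoise P W) (φ : OffDiagStep k) :
    MemLp (φ.integral W) 2 P :=
  memLp_finsetSum _ fun j _ => (hW.memLp_prod _ _ (by simp)).const_mul _

/-- The relabelling of the coordinates of `ℝ^k` by a permutation. -/
theorem measurePreserving_comp_perm (σ : Equiv.Perm (Fin k)) :
    MeasurePreserving (fun (x : Fin k → ℝ) i => x (σ i)) := by
  have h := volume_measurePreserving_piCongrLeft (fun _ : Fin k => ℝ) σ.symm
  convert! h using 1
  ext x i
  simpa [MeasurableEquiv.coe_piCongrLeft] using (Equiv.piCongrLeft_apply_apply (fun _ : Fin k => ℝ) σ.symm x (σ i)).symm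

/-- The second moment of an elementary integral is the sum over all permutations of the inner
products of the step function with its relabellings. -/
theorem integral_integral_sq (hW : IsWhiteNoise P W) (φ : OffDiagStep k) :
    ∫ ω, φ.integral W ω ^ 2 ∂P
      = ∑ σ : Equiv.Perm (Fin k), ∫ x, φ.toFun x * φ.toFun fun i => x (σ.symm i) := by
  have hprod : ∀ (A B : Fin k → FiniteBorel) (σ : Equiv.Perm (Fin k)) (x : Fin k → ℝ),
      Set.indicator (Set.univ.pi fun i => (A i).1) (fun _ => (1 : ℝ)) x *
        Set.indicator (Set.univ.pi fun i => (B i).1) (fun _ => (1 : ℝ)) (fun i => x (σ.symm i))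
      = ∏ i, (A i).1.indicator (fun _ => (1 : ℝ)) (x i) *
          (B (σ i)).1.indicator (fun _ => (1 : ℝ)) (x i) := by
    intro A B σ x
    rw [indicator_box, indicator_box, Finset.prod_mul_distrib]
    congr 1
    rw [← Equiv.prod_comp σ]
    simp
  have hint : ∀ (A B : Fin k → FiniteBorel) (σ : Equiv.Perm (Fin k)),
      Integrable fun x : Fin k → ℝ =>
      Set.indicator (Set.univ.pi fun i => (A i).1) (fun _ => (1 : ℝ)) x *
        Set.indicator (Set.univ.pi fun i => (B i).1) (fun _ => (1 : ℝ)) fun i => x (σ.symm i) := by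
    intro A B σ
    simp_rw [hprod]
    exact Integrable.fintype_prod (f := fun i y => (A i).1.indicator (fun _ => (1 : ℝ)) y *
          (B (σ i)).1.indicator (fun _ => (1 : ℝ)) y) fun i =>
      FiniteBorel.integrable_indicator_mul _ _
  have hint' : ∀ A B : Fin k → FiniteBorel,
      Integrable (fun ω => (∏ i, W (A i) ω) * ∏ i, W (B i) ω) P := fun A B =>
    (hW.memLp_prod _ _ (p := 2) (by simp)).integrable_mul (hW.memLp_prod _ _ (p := 2) (by simp))
  simp_rw [sq, OffDiagStep.integral, toFun, sum_mul_mul_sum_mul]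
  rw [integral_finsetSum _ fun j _ => integrable_finsetSum _ fun l _ => (hint' _ _).const_mul _]
  simp_rw [fun σ : Equiv.Perm (Fin k) => integral_finsetSum Finset.univ fun j _ =>
    integrable_finsetSum Finset.univ fun l _ =>
      (hint (φ.side j) (φ.side l) σ).const_mul (φ.coeff j * φ.coeff l)]
  rw [Finset.sum_comm]
  refine Finset.sum_congr rfl fun j _ => ?_
  rw [integral_finsetSum _ fun l _ => (hint' _ _).const_mul _]
  simp_rw [fun σ : Equiv.Perm (Fin k) => integral_finsetSum Finset.univ fun l _ =>
      (hint (φ.side j) (φ.side l) σ).const_mul (φ.coeff j * φ.coeff l)]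
  rw [Finset.sum_comm]
  refine Finset.sum_congr rfl fun l _ => ?_
  rw [integral_const_mul, hW.integral_prod_mul_prod _ _ (φ.disjoint_side j) (φ.disjoint_side l),
    Finset.mul_sum]
  refine Finset.sum_congr rfl fun σ _ => ?_
  rw [integral_const_mul]
  simp_rw [hprod]
  rw [integral_fintype_prod_volume_eq_prod fun i y => (φ.side j i).1.indicator (fun _ => (1 : ℝ)) y *
          (φ.side l (σ i)).1.indicator (fun _ => (1 : ℝ)) y]
  simp_rw [FiniteBorel.integral_indicator_mul]

/-- The elementary integral is bounded from `L²(ℝ^k)` to `L²(P)`, with norm at most `√(k!)`. -/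
theorem eLpNorm_integral_le (hW : IsWhiteNoise P W) (φ : OffDiagStep k) :
    eLpNorm (φ.integral W) 2 P
      ≤ ENNReal.ofReal (√(k.factorial : ℝ)) * eLpNorm φ.toFun 2 volume := by
  rw [(φ.memLp_integral hW).eLpNorm_two_eq_ofReal_sqrt,
    (φ.memLp_toFun 2).eLpNorm_two_eq_ofReal_sqrt, ← ENNReal.ofReal_mul (Real.sqrt_nonneg _),
    ← Real.sqrt_mul (by positivity)]
  refine ENNReal.ofReal_le_ofReal (Real.sqrt_le_sqrt ?_)
  rw [φ.integral_integral_sq hW]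
  have hbound : ∀ σ : Equiv.Perm (Fin k),
      ∫ x, φ.toFun x * φ.toFun (fun i => x (σ.symm i)) ≤ ∫ x, φ.toFun x ^ 2 := by
    intro σ
    have hσ := measurePreserving_comp_perm σ.symm
    have hi : Integrable fun x => φ.toFun x ^ 2 := (φ.memLp_toFun 2).integrable_sq
    have hm := (φ.memLp_toFun 2).comp_measurePreserving hσ
    have hi' : Integrable fun x : Fin k → ℝ => φ.toFun (fun i => x (σ.symm i)) ^ 2 := hm.integrable_sq
    have heq : ∫ x : Fin k → ℝ, φ.toFun (fun i => x (σ.symm i)) ^ 2 = ∫ x, φ.toFun x ^ 2 := by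
      have := integral_map (f := fun x => φ.toFun x ^ 2) hσ.measurable.aemeasurable
        (by rw [hσ.map_eq]; exact hi.aestronglyMeasurable)
      rw [← this, hσ.map_eq]
    calc ∫ x, φ.toFun x * φ.toFun (fun i => x (σ.symm i))
        ≤ ∫ x, (φ.toFun x ^ 2 + φ.toFun (fun i => x (σ.symm i)) ^ 2) / 2 := by
          refine integral_mono ((φ.memLp_toFun 2).integrable_mul hm) ((hi.add hi').div_const 2)
            fun x => ?_
          have := sq_nonneg (φ.toFun x - φ.toFun fun i => x (σ.symm i))
          simp only
          linarith
      _ = ∫ x, φ.toFun x ^ 2 := by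
          rw [integral_div, integral_add hi hi', heq]; ring
  calc ∑ σ : Equiv.Perm (Fin k), ∫ x, φ.toFun x * φ.toFun (fun i => x (σ.symm i))
      ≤ ∑ _σ : Equiv.Perm (Fin k), ∫ x, φ.toFun x ^ 2 := Finset.sum_le_sum fun σ _ => hbound σ
    _ = _ := by simp [Fintype.card_perm]

end OffDiagStep

/-! ### Density of step functions and existence of multiple integrals -/

section Density

variable {k : ℕ}

/-- Almost every point of `ℝ^k` has pairwise distinct coordinates. -/
theorem ae_injective_volume : ∀ᵐ x : Fin k → ℝ, Function.Injective x := by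
  have h : ∀ i j : Fin k, i ≠ j → ∀ᵐ x : Fin k → ℝ, x i ≠ x j := by
    intro i j hij
    let D : Submodule ℝ (Fin k → ℝ) :=
      LinearMap.ker ((LinearMap.proj i : (Fin k → ℝ) →ₗ[ℝ] ℝ) - LinearMap.proj j)
    have hD : D ≠ ⊤ := by
      intro hD
      have hmem : (Pi.single i 1 : Fin k → ℝ) ∈ D := hD ▸ Submodule.mem_top
      simp [D, hij.symm] at hmem
    have h0 := Measure.addHaar_submodule (volume : Measure (Fin k → ℝ)) D hD
    rw [ae_iff]
    convert! h0 using 2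
    ext x
    simp [D, sub_eq_zero]
  have h' : ∀ᵐ x : Fin k → ℝ, ∀ i j, i ≠ j → x i ≠ x j := by
    simp only [ae_all_iff]
    exact h
  filter_upwards [h'] with x hx i j hij
  by_contra hne
  exact hx i j hne hij

/-- The boxes contained in a given off-diagonal box are off-diagonal and form a π-system generating
its Borel sets. -/
theorem ae_eq_zero_on_box {f : (Fin k → ℝ) → ℝ} (hf : MemLp f 2 volume)
    (h0 : ∀ A : Fin k → FiniteBorel, (∀ i i', i ≠ i' → Disjoint (A i).1 (A i').1) →
      ∫ x in Set.univ.pi fun i => (A i).1, f x = 0)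
    (A : Fin k → FiniteBorel) (hA : ∀ i i', i ≠ i' → Disjoint (A i).1 (A i').1) :
    ∀ᵐ x, x ∈ (Set.univ.pi fun i => (A i).1) → f x = 0 := by
  set U := Set.univ.pi fun i => (A i).1 with hU
  have hUm : MeasurableSet U := OffDiagStep.measurableSet_box A
  have : IsFiniteMeasure (volume.restrict U) :=
    ⟨by simpa using OffDiagStep.volume_box_lt_top A⟩
  have hfU : Integrable f (volume.restrict U) := (hf.restrict U).integrable (by norm_num)
  rw [← ae_restrict_iff' hUm]
  refine hfU.ae_eq_zero_of_forall_setIntegral_eq_zero fun S hS hlt => ?_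
  clear hlt
  refine MeasurableSpace.induction_on_inter
    (C := fun S _ => ∫ x in S, f x ∂volume.restrict U = 0)
    generateFrom_pi.symm isPiSystem_pi ?_ ?_ ?_ ?_ S hS
  · simp
  · intro t ht
    obtain ⟨B, hB, rfl⟩ := ht
    have hBm : ∀ i, MeasurableSet (B i) := fun i => hB i (Set.mem_univ i)
    rw [Measure.restrict_restrict (MeasurableSet.univ_pi hBm), hU, ← Set.pi_inter_distrib]
    exact h0 (fun i => ⟨B i ∩ (A i).1, (hBm i).inter (A i).2.1,
      (measure_mono Set.inter_subset_right).trans_lt (A i).2.2⟩) fun i i' h =>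
        (hA i i' h).mono Set.inter_subset_right Set.inter_subset_right
  · intro t ht ih
    have h1 := integral_add_compl ht hfU
    have h2 : ∫ x in U, f x = 0 := h0 A hA
    linarith
  · intro B hd hB ih
    rw [integral_iUnion hB hd hfU.integrableOn]
    simp [ih]

/-- Off-diagonal boxes separate `L²(ℝ^k)`: the off-diagonal cells of the grids of mesh `1 / N`
exhaust the complement of the diagonals. -/
theorem ae_eq_zero_of_forall_integral_box_eq_zero {f : (Fin k → ℝ) → ℝ} (hf : MemLp f 2 volume)
    (h0 : ∀ A : Fin k → FiniteBorel, (∀ i i', i ≠ i' → Disjoint (A i).1 (A i').1) →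
      ∫ x in Set.univ.pi fun i => (A i).1, f x = 0) : f =ᵐ[volume] 0 := by
  let I : ℕ → ℤ → FiniteBorel := fun N m => ⟨{y : ℝ | ⌊((N : ℝ) + 1) * y⌋ = m}, by
    refine ⟨?_, ?_⟩
    · have : Measurable fun y : ℝ => ⌊((N : ℝ) + 1) * y⌋ := by fun_prop
      exact this (measurableSet_singleton m)
    · refine (measure_mono (t := Set.Icc ((m : ℝ) / (N + 1)) ((m + 1 : ℝ) / (N + 1))) ?_).trans_lt
        (by simp)
      intro y hy
      have h1 := Int.floor_eq_iff.1 hy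
      have hN : (0 : ℝ) < N + 1 := by positivity
      refine ⟨?_, ?_⟩
      · rw [div_le_iff₀ hN]; linarith [h1.1]
      · rw [le_div_iff₀ hN]; linarith [h1.2]⟩
  have hI : ∀ N m m', m ≠ m' → Disjoint (I N m).1 (I N m').1 := by
    intro N m m' h
    refine Set.disjoint_left.2 fun y hy hy' => h ?_
    rw [← (show _ = m from hy), ← (show _ = m' from hy')]
  have hall : ∀ᵐ x : Fin k → ℝ, ∀ (N : ℕ) (m : Fin k → ℤ), Function.Injective m →
      x ∈ (Set.univ.pi fun i => (I N (m i)).1) → f x = 0 := by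
    simp only [ae_all_iff]
    exact fun N m hm => ae_eq_zero_on_box hf h0 (fun i => I N (m i)) fun i i' h =>
      hI _ _ _ fun h' => h (hm h')
  filter_upwards [hall, ae_injective_volume] with x hx hinj
  -- a mesh so fine that distinct coordinates fall into distinct cells
  have hN : ∀ᶠ N : ℕ in atTop, ∀ i j : Fin k, i ≠ j → 1 ≤ ((N : ℝ) + 1) * |x i - x j| := by
    rw [eventually_all]; intro i
    rw [eventually_all]; intro j
    by_cases hij : i = j
    · simp [hij]
    have hpos : 0 < |x i - x j| := abs_pos.2 (sub_ne_zero.2 fun h => hij (hinj h))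
    have : Tendsto (fun N : ℕ => ((N : ℝ) + 1) * |x i - x j|) atTop atTop :=
      (tendsto_atTop_add_const_right _ _ tendsto_natCast_atTop_atTop).atTop_mul_const hpos
    filter_upwards [this.eventually_ge_atTop 1] with N hN _ using hN
  obtain ⟨N, hN⟩ := hN.exists
  refine hx N (fun i => ⌊((N : ℝ) + 1) * x i⌋) (fun i j hij => ?_) (by simp [I])
  by_contra hne
  have h1 := Int.abs_sub_lt_one_of_floor_eq_floor hij
  rw [← mul_sub, abs_mul, abs_of_pos (by positivity : (0 : ℝ) < N + 1)] at h1
  linarith [hN i j hne]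

/-- Off-diagonal step functions are dense in `L²(ℝ^k)`. -/
theorem OffDiagStep.exists_tendsto {f : (Fin k → ℝ) → ℝ} (hf : MemLp f 2 volume) :
    ∃ φ : ℕ → OffDiagStep k, Tendsto (fun n => eLpNorm ((φ n).toFun - f) 2 volume) atTop (𝓝 0) := by
  let K : Submodule ℝ (Lp ℝ 2 (volume : Measure (Fin k → ℝ))) :=
    { carrier := {u | ∃ φ : OffDiagStep k, u =ᵐ[volume] φ.toFun}
      add_mem' := by
        rintro u v ⟨φ, hφ⟩ ⟨ψ, hψ⟩
        refine ⟨smulAdd 1 φ ψ, ?_⟩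
        rw [toFun_smulAdd, one_smul]
        exact (Lp.coeFn_add u v).trans (hφ.add hψ)
      zero_mem' := by
        refine ⟨⟨0, Fin.elim0, fun j => j.elim0, fun j => j.elim0⟩, ?_⟩
        filter_upwards [Lp.coeFn_zero ℝ 2 (volume : Measure (Fin k → ℝ))] with x hx
        rw [hx]
        exact (Finset.sum_empty).symm
      smul_mem' := by
        rintro c u ⟨φ, hφ⟩
        refine ⟨smulAdd (c - 1) φ φ, ?_⟩
        rw [toFun_smulAdd]
        filter_upwards [Lp.coeFn_smul c u, hφ] with x h1 h2
        rw [h1, Pi.smul_apply, h2, Pi.add_apply, Pi.smul_apply, smul_eq_mul, smul_eq_mul]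
        ring }
  have hK : K.topologicalClosure = ⊤ := by
    rw [Submodule.topologicalClosure_eq_top_iff, Submodule.eq_bot_iff]
    intro u hu
    rw [Submodule.mem_orthogonal] at hu
    refine Lp.eq_zero_iff_ae_eq_zero.2
      (ae_eq_zero_of_forall_integral_box_eq_zero (Lp.memLp u) fun A hA => ?_)
    let φ : OffDiagStep k := ⟨1, fun _ => 1, fun _ => A, fun _ => hA⟩
    have hφ : φ.toFun = Set.indicator (Set.univ.pi fun i => (A i).1) fun _ => (1 : ℝ) := by
      ext x
      exact (Fin.sum_univ_one _).trans (one_mul _)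
    have h := hu ((φ.memLp_toFun 2).toLp _) ⟨φ, MemLp.coeFn_toLp _⟩
    rw [L2.inner_def] at h
    rw [← h, ← integral_indicator (measurableSet_box A)]
    refine integral_congr_ae ?_
    filter_upwards [(φ.memLp_toFun 2).coeFn_toLp] with x hx
    rw [hx, hφ]
    by_cases hxA : x ∈ Set.univ.pi fun i => (A i).1
    · simp only [Set.indicator_of_mem hxA]; simp
    · simp only [Set.indicator_of_notMem hxA]; simp
  have hmem : hf.toLp f ∈ closure (K : Set (Lp ℝ 2 (volume : Measure (Fin k → ℝ)))) := by
    rw [← Submodule.topologicalClosure_coe, hK]; trivial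
  obtain ⟨u, huK, hu⟩ := mem_closure_iff_seq_limit.1 hmem
  choose φ hφ using huK
  refine ⟨φ, ?_⟩
  rw [Lp.tendsto_Lp_iff_tendsto_eLpNorm] at hu
  refine hu.congr fun n => eLpNorm_congr_ae ?_
  exact (hφ n).sub (ae_eq_refl f)

end Density

section Integral

variable {k : ℕ} {Ω : Type*} [MeasurableSpace Ω] {P : Measure Ω} {W : FiniteBorel → Ω → ℝ}
  {f g : (Fin k → ℝ) → ℝ} {X Y : Ω → ℝ}

theorem tendsto_eLpNorm_smul_add {α : Type*} [MeasurableSpace α] {μ : Measure α} (c : ℝ)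
    {u v : ℕ → α → ℝ} {f g : α → ℝ} (hu : ∀ n, MemLp (u n) 2 μ) (hv : ∀ n, MemLp (v n) 2 μ)
    (hf : MemLp f 2 μ) (hg : MemLp g 2 μ)
    (h1 : Tendsto (fun n => eLpNorm (u n - f) 2 μ) atTop (𝓝 0))
    (h2 : Tendsto (fun n => eLpNorm (v n - g) 2 μ) atTop (𝓝 0)) :
    Tendsto (fun n => eLpNorm ((c • u n + v n) - (c • f + g)) 2 μ) atTop (𝓝 0) := by
  have h3 : Tendsto (fun n => ‖c‖ₑ * eLpNorm (u n - f) 2 μ + eLpNorm (v n - g) 2 μ)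
      atTop (𝓝 0) := by
    simpa using (ENNReal.Tendsto.const_mul h1 (Or.inr (by simp))).add h2
  refine tendsto_of_tendsto_of_tendsto_of_le_of_le tendsto_const_nhds h3 (fun _ => zero_le)
    fun n => ?_
  have : (c • u n + v n) - (c • f + g) = c • (u n - f) + (v n - g) := by
    rw [smul_sub]; abel
  rw [this]
  refine (eLpNorm_add_le (((hu n).sub hf).const_smul c).aestronglyMeasurable
    ((hv n).sub hg).aestronglyMeasurable (by norm_num)).trans ?_
  rw [eLpNorm_const_smul]

namespace IsMultipleWienerIntegral

theorem congr_ae (h : IsMultipleWienerIntegral P W f X) (hfg : f =ᵐ[volume] g)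
    (hXY : X =ᵐ[P] Y) : IsMultipleWienerIntegral P W g Y := by
  obtain ⟨hf, hX, φ, h1, h2⟩ := h
  refine ⟨hf.ae_eq hfg, hX.ae_eq hXY, φ, h1.congr fun n => eLpNorm_congr_ae ?_,
    h2.congr fun n => eLpNorm_congr_ae ?_⟩
  · exact (ae_eq_refl _).sub hfg
  · exact (ae_eq_refl _).sub hXY

theorem smul_add (hW : IsWhiteNoise P W) (c : ℝ) (h : IsMultipleWienerIntegral P W f X)
    (h' : IsMultipleWienerIntegral P W g Y) :
    IsMultipleWienerIntegral P W (c • f + g) (c • X + Y) := by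
  obtain ⟨hf, hX, φ, h1, h2⟩ := h
  obtain ⟨hg, hY, ψ, h1', h2'⟩ := h'
  refine ⟨(hf.const_smul c).add hg, (hX.const_smul c).add hY,
    fun n => OffDiagStep.smulAdd c (φ n) (ψ n), ?_, ?_⟩
  · simp_rw [OffDiagStep.toFun_smulAdd]
    exact tendsto_eLpNorm_smul_add c (fun n => (φ n).memLp_toFun 2) (fun n => (ψ n).memLp_toFun 2)
      hf hg h1 h1'
  · simp_rw [OffDiagStep.integral_smulAdd]
    exact tendsto_eLpNorm_smul_add c (fun n => (φ n).memLp_integral hW)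
      (fun n => (ψ n).memLp_integral hW) hX hY h2 h2'

theorem ae_eq_zero (hW : IsWhiteNoise P W) (h : IsMultipleWienerIntegral P W f X)
    (hf0 : f =ᵐ[volume] 0) : X =ᵐ[P] 0 := by
  obtain ⟨hf, hX, φ, h1, h2⟩ := h
  have h1' : Tendsto (fun n => eLpNorm (φ n).toFun 2 volume) atTop (𝓝 0) := by
    refine h1.congr fun n => eLpNorm_congr_ae ?_
    filter_upwards [hf0] with x hx
    simp [hx]
  have h3 : Tendsto (fun n => ENNReal.ofReal (√(k.factorial : ℝ)) * eLpNorm (φ n).toFun 2 volume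
      + eLpNorm ((φ n).integral W - X) 2 P) atTop (𝓝 0) := by
    simpa using (ENNReal.Tendsto.const_mul h1' (Or.inr (by simp))).add h2
  have h4 : eLpNorm X 2 P ≤ 0 := by
    refine ge_of_tendsto' h3 fun n => ?_
    have hXeq : X = (φ n).integral W - ((φ n).integral W - X) := by abel
    calc eLpNorm X 2 P = eLpNorm ((φ n).integral W - ((φ n).integral W - X)) 2 P := by
          rw [← hXeq]
      _ ≤ eLpNorm ((φ n).integral W) 2 P + eLpNorm ((φ n).integral W - X) 2 P :=
          eLpNorm_sub_le ((φ n).memLp_integral hW).aestronglyMeasurable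
            (((φ n).memLp_integral hW).sub hX).aestronglyMeasurable (by norm_num)
      _ ≤ _ := by gcongr; exact (φ n).eLpNorm_integral_le hW
  exact (eLpNorm_eq_zero_iff hX.aestronglyMeasurable (by norm_num)).1 (le_antisymm h4 zero_le)

/-- The multiple integral is unique up to null sets. -/
theorem ae_unique (hW : IsWhiteNoise P W) (h : IsMultipleWienerIntegral P W f X)
    (h' : IsMultipleWienerIntegral P W g Y) (hfg : f =ᵐ[volume] g) : X =ᵐ[P] Y := by
  have h0 := (h.smul_add hW (-1) h').ae_eq_zero hW (by
    filter_upwards [hfg] with x hx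
    simp [hx])
  filter_upwards [h0] with ω hω
  simp only [Pi.add_apply, Pi.smul_apply, smul_eq_mul, Pi.zero_apply] at hω
  linarith

/-- The multiple integral exists for every `f ∈ L²(ℝ^k)`. -/
theorem exists_of_memLp (hW : IsWhiteNoise P W) (hf : MemLp f 2 volume) :
    ∃ X, IsMultipleWienerIntegral P W f X := by
  obtain ⟨φ, hφ⟩ := OffDiagStep.exists_tendsto hf
  let F : ℕ → Lp ℝ 2 (volume : Measure (Fin k → ℝ)) := fun n => ((φ n).memLp_toFun 2).toLp _
  let G : ℕ → Lp ℝ 2 P := fun n => ((φ n).memLp_integral hW).toLp _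
  have hF : CauchySeq F := by
    have : Tendsto F atTop (𝓝 (hf.toLp f)) := by
      rwa [Lp.tendsto_Lp_iff_tendsto_eLpNorm'' (fun n => (φ n).toFun)]
    exact this.cauchySeq
  have hbound : ∀ m n, dist (G m) (G n) ≤ √(k.factorial : ℝ) * dist (F m) (F n) := by
    intro m n
    rw [Lp.dist_def, Lp.dist_def, ← ENNReal.toReal_ofReal (Real.sqrt_nonneg (k.factorial : ℝ)),
      ← ENNReal.toReal_mul]
    have e1 : eLpNorm (⇑(G m) - ⇑(G n)) 2 P
        = eLpNorm ((OffDiagStep.smulAdd (-1) (φ n) (φ m)).integral W) 2 P := by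
      refine eLpNorm_congr_ae ?_
      filter_upwards [((φ m).memLp_integral hW).coeFn_toLp, ((φ n).memLp_integral hW).coeFn_toLp]
        with ω h1 h2
      simp only [Pi.sub_apply, G, h1, h2, OffDiagStep.integral_smulAdd, Pi.add_apply,
        Pi.smul_apply, smul_eq_mul]
      ring
    have e2 : eLpNorm (⇑(F m) - ⇑(F n)) 2 volume
        = eLpNorm (OffDiagStep.smulAdd (-1) (φ n) (φ m)).toFun 2 volume := by
      refine eLpNorm_congr_ae ?_
      filter_upwards [((φ m).memLp_toFun 2).coeFn_toLp, ((φ n).memLp_toFun 2).coeFn_toLp]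
        with ω h1 h2
      simp only [Pi.sub_apply, F, h1, h2, OffDiagStep.toFun_smulAdd, Pi.add_apply,
        Pi.smul_apply, smul_eq_mul]
      ring
    rw [e1, e2]
    exact ENNReal.toReal_mono
      (ENNReal.mul_ne_top (by simp) (OffDiagStep.memLp_toFun _ 2).eLpNorm_ne_top)
      (OffDiagStep.eLpNorm_integral_le hW _)
  have hG : CauchySeq G := by
    rw [cauchySeq_iff_tendsto_dist_atTop_0] at hF ⊢
    refine squeeze_zero (fun _ => dist_nonneg) (fun n => hbound n.1 n.2) ?_
    simpa using hF.const_mul (√(k.factorial : ℝ))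
  obtain ⟨X, hX⟩ := cauchySeq_tendsto_of_complete hG
  refine ⟨X, hf, Lp.memLp X, φ, hφ, ?_⟩
  rw [Lp.tendsto_Lp_iff_tendsto_eLpNorm'] at hX
  refine hX.congr fun n => eLpNorm_congr_ae ?_
  exact (MemLp.coeFn_toLp _).sub (ae_eq_refl _)

end IsMultipleWienerIntegral

theorem isMultipleWienerIntegral_multipleWienerIntegral (hW : IsWhiteNoise P W)
    (hf : MemLp f 2 volume) :
    IsMultipleWienerIntegral P W f (multipleWienerIntegral P W f) := by
  have h := IsMultipleWienerIntegral.exists_of_memLp hW hf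
  rw [multipleWienerIntegral, dif_pos h]
  exact h.choose_spec

end Integral

/-! ### Laws of multiple integrals and affine changes of variable -/

section Law

variable {k : ℕ} {Ω : Type*} [MeasurableSpace Ω] {P : Measure Ω} {W W' : FiniteBorel → Ω → ℝ}

/-- Any two white noises have the same finite-dimensional distributions: these are centred Gaussian
laws with a common covariance. -/
theorem IsWhiteNoise.identDistrib_restrict (hW : IsWhiteNoise P W) (hW' : IsWhiteNoise P W')
    (s : Finset FiniteBorel) :
    IdentDistrib (fun ω => s.restrict (W · ω)) (fun ω => s.restrict (W' · ω)) P P := by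
  classical
  have := hW.isGaussian.isProbabilityMeasure
  have hG := hW.isGaussian.hasGaussianLaw s
  have hG' := hW'.isGaussian.hasGaussianLaw s
  refine ⟨hG.aemeasurable, hG'.aemeasurable, ?_⟩
  have := Measure.isProbabilityMeasure_map (μ := P) hG.aemeasurable
  have := Measure.isProbabilityMeasure_map (μ := P) hG'.aemeasurable
  refine Measure.ext_of_charFunDual (funext fun L => ?_)
  rw [hG.charFunDual_map_eq_fun, hG'.charFunDual_map_eq_fun]
  have hL : ∀ V : FiniteBorel → Ω → ℝ, (fun ω => L (s.restrict (V · ω)))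
      = fun ω => ∑ i : s, L (Pi.single i 1) * V i ω := by
    intro V
    ext ω
    conv_lhs => rw [← Finset.univ_sum_single (s.restrict (V · ω)), map_sum]
    refine Finset.sum_congr rfl fun i _ => ?_
    have : (Pi.single i (s.restrict (V · ω) i) : s → ℝ) = (V i ω) • Pi.single i 1 := by
      rw [← Pi.single_smul]; simp
    rw [this, map_smul, smul_eq_mul, mul_comm]
  have hmean : ∀ V : FiniteBorel → Ω → ℝ, IsWhiteNoise P V →
      ∫ ω, L (s.restrict (V · ω)) ∂P = 0 := by
    intro V hV
    rw [hL V, integral_finsetSum _ fun i _ => (hV.hasGaussianLaw _).integrable.const_mul _]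
    simp [integral_const_mul, hV.centered]
  have hvar : ∀ V : FiniteBorel → Ω → ℝ, IsWhiteNoise P V →
      Var[fun ω => L (s.restrict (V · ω)); P]
        = ∫ x, (∑ i : s, L (Pi.single i 1) * i.1.1.indicator (fun _ => (1 : ℝ)) x)
            * (∑ i : s, L (Pi.single i 1) * i.1.1.indicator (fun _ => (1 : ℝ)) x) := by
    intro V hV
    have hm := hmean V hV
    rw [variance_of_integral_eq_zero _ hm, ← hV.integral_sum_mul_sum]
    · refine integral_congr_ae (ae_of_all _ fun ω => ?_)
      have := congrFun (hL V) ω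
      simp only at this ⊢
      rw [this, sq]
    · exact ((hV.isGaussian.hasGaussianLaw s).map_fun L).aemeasurable
  rw [hmean W hW, hmean W' hW', hvar W hW, hvar W' hW']

/-- Elementary integrals are polynomials in finitely many values of the white noise. -/
theorem OffDiagStep.identDistrib_integral (hW : IsWhiteNoise P W) (hW' : IsWhiteNoise P W')
    {ι : Type*} [Fintype ι] (φ : ι → OffDiagStep k) :
    IdentDistrib (fun ω t => (φ t).integral W ω) (fun ω t => (φ t).integral W' ω) P P := by
  classical
  let s : Finset FiniteBorel := Finset.univ.biUnion fun t : ι =>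
    Finset.univ.biUnion fun j : Fin (φ t).n => Finset.univ.image ((φ t).side j)
  have hs : ∀ t j i, (φ t).side j i ∈ s := fun t j i =>
    Finset.mem_biUnion.2 ⟨t, Finset.mem_univ _, Finset.mem_biUnion.2 ⟨j, Finset.mem_univ _,
      Finset.mem_image_of_mem _ (Finset.mem_univ _)⟩⟩
  let G : (s → ℝ) → ι → ℝ := fun y t => ∑ j, (φ t).coeff j * ∏ i, y ⟨(φ t).side j i, hs t j i⟩
  have hG : Measurable G := by fun_prop
  exact (hW.identDistrib_restrict hW' s).comp hG

theorem tendstoInMeasure_pi_of_tendsto_eLpNorm {ι : Type*} [Fintype ι]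
    {u : ι → ℕ → Ω → ℝ} {X : ι → Ω → ℝ} (hu : ∀ t n, MemLp (u t n) 2 P)
    (hX : ∀ t, MemLp (X t) 2 P)
    (h : ∀ t, Tendsto (fun n => eLpNorm (u t n - X t) 2 P) atTop (𝓝 0)) :
    TendstoInMeasure P (fun n ω t => u t n ω) atTop (fun ω t => X t ω) := by
  refine tendstoInMeasure_of_tendsto_eLpNorm (p := 2) (by norm_num)
    (fun n => (aemeasurable_pi_lambda _ fun t =>
      (hu t n).aestronglyMeasurable.aemeasurable).aestronglyMeasurable)
    (aemeasurable_pi_lambda _ fun t =>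
      (hX t).aestronglyMeasurable.aemeasurable).aestronglyMeasurable ?_
  have h' : Tendsto (fun n => ∑ t, eLpNorm (u t n - X t) 2 P) atTop (𝓝 0) := by
    simpa using tendsto_finsetSum Finset.univ fun t _ => h t
  refine tendsto_of_tendsto_of_tendsto_of_le_of_le tendsto_const_nhds h' (fun _ => zero_le)
    fun n => ?_
  calc eLpNorm ((fun ω t => u t n ω) - fun ω t => X t ω) 2 P
      ≤ eLpNorm (∑ t, fun ω => ‖(u t n - X t) ω‖) 2 P := by
        refine eLpNorm_mono_real fun ω => ?_
        rw [Finset.sum_apply]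
        exact (pi_norm_le_iff_of_nonneg (Finset.sum_nonneg fun t _ => norm_nonneg _)).2 fun t =>
          Finset.single_le_sum (f := fun t => ‖(u t n - X t) ω‖) (fun t _ => norm_nonneg _)
            (Finset.mem_univ t)
    _ ≤ ∑ t, eLpNorm (fun ω => ‖(u t n - X t) ω‖) 2 P :=
        eLpNorm_sum_le (fun t _ => ((hu t n).sub (hX t)).aestronglyMeasurable.norm) (by norm_num)
    _ = ∑ t, eLpNorm (u t n - X t) 2 P := by simp only [eLpNorm_norm]

/-- The joint law of multiple integrals depends on the kernels only, not on the white noise. -/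
theorem IsMultipleWienerIntegral.identDistrib (hW : IsWhiteNoise P W) (hW' : IsWhiteNoise P W')
    {ι : Type*} [Fintype ι] {f : ι → (Fin k → ℝ) → ℝ} {X X' : ι → Ω → ℝ}
    (h : ∀ t, IsMultipleWienerIntegral P W (f t) (X t))
    (h' : ∀ t, IsMultipleWienerIntegral P W' (f t) (X' t)) :
    IdentDistrib (fun ω t => X t ω) (fun ω t => X' t ω) P P := by
  have := hW.isGaussian.isProbabilityMeasure
  have hf : ∀ t, MemLp (f t) 2 volume := fun t => (h t).1
  choose _ hX φ hφ hφX using h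
  -- the integrals with respect to `W'` of the same step functions converge to `X'`
  have hφX' : ∀ t, Tendsto (fun n => eLpNorm ((φ t n).integral W' - X' t) 2 P) atTop (𝓝 0) := by
    intro t
    obtain ⟨_, hX', ψ, hψ, hψX'⟩ := h' t
    have h1 := tendsto_eLpNorm_smul_add (-1) (fun n => (ψ n).memLp_toFun 2)
      (fun n => (φ t n).memLp_toFun 2) (hf t) (hf t) hψ (hφ t)
    have h2 : Tendsto (fun n => ENNReal.ofReal (√(k.factorial : ℝ)) *
        eLpNorm (OffDiagStep.smulAdd (-1) (ψ n) (φ t n)).toFun 2 volume) atTop (𝓝 0) := by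
      have h3 : Tendsto (fun n => eLpNorm (OffDiagStep.smulAdd (-1) (ψ n) (φ t n)).toFun 2 volume)
          atTop (𝓝 0) := by
        refine h1.congr fun n => ?_
        rw [OffDiagStep.toFun_smulAdd]
        congr 1
        simp
      simpa using ENNReal.Tendsto.const_mul h3 (Or.inr (by simp))
    have h4 := h2.add hψX'
    rw [add_zero] at h4
    refine tendsto_of_tendsto_of_tendsto_of_le_of_le tendsto_const_nhds h4 (fun _ => zero_le)
      fun n => ?_
    have heq : (φ t n).integral W' - X' t
        = (OffDiagStep.smulAdd (-1) (ψ n) (φ t n)).integral W' + ((ψ n).integral W' - X' t) := by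
      rw [OffDiagStep.integral_smulAdd, neg_one_smul]; abel
    rw [heq]
    refine (eLpNorm_add_le (OffDiagStep.memLp_integral hW' _).aestronglyMeasurable
      (((ψ n).memLp_integral hW').sub hX').aestronglyMeasurable (by norm_num)).trans ?_
    gcongr
    exact OffDiagStep.eLpNorm_integral_le hW' _
  have hX' : ∀ t, MemLp (X' t) 2 P := fun t => (h' t).2.1
  have hI : ∀ (V : FiniteBorel → Ω → ℝ), IsWhiteNoise P V → ∀ n,
      AEMeasurable (fun ω t => (φ t n).integral V ω) P := fun V hV n =>
    aemeasurable_pi_lambda _ fun t =>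
      ((φ t n).memLp_integral hV).aestronglyMeasurable.aemeasurable
  have T := (tendstoInMeasure_pi_of_tendsto_eLpNorm
    (fun t n => (φ t n).memLp_integral hW) hX hφX).tendstoInDistribution (hI W hW)
  have T' := (tendstoInMeasure_pi_of_tendsto_eLpNorm
    (fun t n => (φ t n).memLp_integral hW') hX' hφX').tendstoInDistribution (hI W' hW')
  refine ⟨T.aemeasurable_limit, T'.aemeasurable_limit, ?_⟩
  have h1 := T.tendsto
  have h2 := T'.tendsto
  have heq : ∀ n, P.map (fun ω t => (φ t n).integral W ω)
      = P.map (fun ω t => (φ t n).integral W' ω) := fun n =>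
    (OffDiagStep.identDistrib_integral hW hW' fun t => φ t n).map_eq
  have h3 := tendsto_nhds_unique h1 (h2.congr fun n => Subtype.ext (heq n).symm)
  exact congrArg Subtype.val h3

end Law

section Affine

/-- The image of `A` under the affine map `y ↦ c y + h`, written as a preimage. -/
def FiniteBorel.affine (c h : ℝ) (hc : 0 < c) (A : FiniteBorel) : FiniteBorel :=
  ⟨(fun y => c⁻¹ * (y - h)) ⁻¹' A.1, by
    refine ⟨(by fun_prop : Measurable fun y : ℝ => c⁻¹ * (y - h)) A.2.1, ?_⟩
    have : (fun y => c⁻¹ * (y - h)) ⁻¹' A.1 = (fun y => y + -h) ⁻¹' ((fun y => c⁻¹ * y) ⁻¹' A.1) :=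
      by ext; simp [sub_eq_add_neg]
    rw [this, measure_preimage_add_right, Real.volume_preimage_mul_left (inv_ne_zero hc.ne')]
    exact ENNReal.mul_lt_top (by simp) A.2.2⟩

theorem volume_real_preimage_affine {c : ℝ} (hc : 0 < c) (h : ℝ) (A : Set ℝ) :
    volume.real ((fun y => c⁻¹ * (y - h)) ⁻¹' A) = c * volume.real A := by
  have : (fun y => c⁻¹ * (y - h)) ⁻¹' A = (fun y => y + -h) ⁻¹' ((fun y => c⁻¹ * y) ⁻¹' A) := by
    ext; simp [sub_eq_add_neg]
  rw [Measure.real, this, measure_preimage_add_right,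
    Real.volume_preimage_mul_left (inv_ne_zero hc.ne'), ENNReal.toReal_mul, inv_inv, abs_of_pos hc,
    ENNReal.toReal_ofReal hc.le, Measure.real]

variable {k : ℕ} {Ω : Type*} [MeasurableSpace Ω] {P : Measure Ω} {W : FiniteBorel → Ω → ℝ}

/-- Brownian scaling and translation: `A ↦ c^{-1/2} W(c A + h)` is again a white noise. -/
theorem IsWhiteNoise.affine (hW : IsWhiteNoise P W) {c : ℝ} (hc : 0 < c) (h : ℝ) :
    IsWhiteNoise P fun A ω => (√c)⁻¹ * W (A.affine c h hc) ω where
  isGaussian := (hW.isGaussian.comp_right fun A : FiniteBorel => A.affine c h hc).smul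
    fun _ => (√c)⁻¹
  centered A := by rw [integral_const_mul, hW.centered, mul_zero]
  covariance A B := by
    rw [integral_congr_ae (ae_of_all _ fun ω => mul_mul_mul_comm _ _ _ _),
      integral_const_mul, hW.covariance]
    have := volume_real_preimage_affine hc h (A.1 ∩ B.1)
    rw [Set.preimage_inter] at this
    rw [FiniteBorel.affine, FiniteBorel.affine, this, ← mul_inv, Real.mul_self_sqrt hc.le,
      ← mul_assoc, inv_mul_cancel₀ hc.ne', one_mul]

theorem map_volume_affine {c : ℝ} (hc : 0 < c) (h : Fin k → ℝ) :
    Measure.map (fun x : Fin k → ℝ => c⁻¹ • (x - h)) volume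
      = ENNReal.ofReal (c ^ k) • (volume : Measure (Fin k → ℝ)) := by
  have h1 : (fun x : Fin k → ℝ => c⁻¹ • (x - h)) = (fun x => c⁻¹ • x) ∘ fun x => x - h := rfl
  rw [h1, ← Measure.map_map (by fun_prop) (by fun_prop),
    (measurePreserving_sub_right volume h).map_eq,
    Measure.map_addHaar_smul _ (inv_ne_zero hc.ne')]
  simp [abs_of_pos (pow_pos hc k)]

theorem eLpNorm_comp_affine {c : ℝ} (hc : 0 < c) (h : Fin k → ℝ) {f : (Fin k → ℝ) → ℝ}
    (hf : AEStronglyMeasurable f volume) :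
    eLpNorm (fun x => f (c⁻¹ • (x - h))) 2 volume
      = ENNReal.ofReal (c ^ k) ^ (1 / 2 : ℝ) * eLpNorm f 2 volume := by
  have h1 := eLpNorm_map_measure (p := 2) (μ := volume) (g := f)
    (f := fun x : Fin k → ℝ => c⁻¹ • (x - h))
    (by rw [map_volume_affine hc]; exact hf.smul_measure _) (by fun_prop)
  rw [map_volume_affine hc, eLpNorm_smul_measure_of_ne_top (by simp)] at h1
  change eLpNorm (f ∘ fun x : Fin k → ℝ => c⁻¹ • (x - h)) 2 volume = _
  rw [← h1]
  simp

/-- The step function `x ↦ φ(c⁻¹(x - h))`. -/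
def OffDiagStep.affine (c h : ℝ) (hc : 0 < c) (φ : OffDiagStep k) : OffDiagStep k where
  n := φ.n
  coeff := φ.coeff
  side j i := (φ.side j i).affine c h hc
  disjoint_side j i i' hi := (φ.disjoint_side j i i' hi).preimage _

theorem OffDiagStep.toFun_affine {c : ℝ} (hc : 0 < c) (h : ℝ) (φ : OffDiagStep k) :
    (φ.affine c h hc).toFun = fun x => φ.toFun (c⁻¹ • (x - fun _ => h)) := by
  classical
  ext x
  refine Finset.sum_congr rfl fun j _ => ?_
  simp [Set.indicator_apply, OffDiagStep.affine, FiniteBorel.affine]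

theorem OffDiagStep.integral_affine {Ω' : Type*} {W : FiniteBorel → Ω' → ℝ} {c : ℝ} (hc : 0 < c) (h : ℝ) (φ : OffDiagStep k) :
    (φ.affine c h hc).integral W
      = √c ^ k • φ.integral fun A ω => (√c)⁻¹ * W (A.affine c h hc) ω := by
  ext ω
  rw [Pi.smul_apply, smul_eq_mul, OffDiagStep.integral, OffDiagStep.integral, Finset.mul_sum]
  refine Finset.sum_congr rfl fun j _ => ?_
  have h0 : (√c) ^ k * ((√c)⁻¹) ^ k = 1 := by
    rw [← mul_pow, mul_inv_cancel₀ (Real.sqrt_pos.2 hc).ne', one_pow]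
  rw [Finset.prod_mul_distrib, Finset.prod_const, Finset.card_univ, Fintype.card_fin]
  change φ.coeff j * ∏ i, W ((φ.side j i).affine c h hc) ω = _
  linear_combination (-(φ.coeff j * ∏ i, W ((φ.side j i).affine c h hc) ω)) * h0

/-- Change of variables in multiple integrals. -/
theorem IsMultipleWienerIntegral.affine {c : ℝ} (hc : 0 < c) (h : ℝ)
    {f : (Fin k → ℝ) → ℝ} {X : Ω → ℝ}
    (hX : IsMultipleWienerIntegral P (fun A ω => (√c)⁻¹ * W (A.affine c h hc) ω) f X) :
    IsMultipleWienerIntegral P W (fun x => f (c⁻¹ • (x - fun _ => h))) (√c ^ k • X) := by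
  obtain ⟨hf, hXm, φ, h1, h2⟩ := hX
  have hq : Measure.QuasiMeasurePreserving (fun x : Fin k → ℝ => c⁻¹ • (x - fun _ => h)) := by
    refine ⟨by fun_prop, ?_⟩
    rw [map_volume_affine hc]
    exact Measure.smul_absolutelyContinuous
  refine ⟨⟨hf.aestronglyMeasurable.comp_quasiMeasurePreserving hq, ?_⟩, hXm.const_smul _,
    fun n => (φ n).affine c h hc, ?_, ?_⟩
  · rw [eLpNorm_comp_affine hc _ hf.aestronglyMeasurable]
    exact ENNReal.mul_lt_top (ENNReal.rpow_lt_top_of_nonneg (by norm_num) (by simp))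
      hf.eLpNorm_lt_top
  · have h3 : Tendsto (fun n => ENNReal.ofReal (c ^ k) ^ (1 / 2 : ℝ) *
        eLpNorm ((φ n).toFun - f) 2 volume) atTop (𝓝 0) := by
      simpa using ENNReal.Tendsto.const_mul h1
        (Or.inr (ENNReal.rpow_ne_top_of_nonneg (by norm_num) (by simp)))
    refine h3.congr fun n => ?_
    rw [← eLpNorm_comp_affine hc (fun _ => h) (((φ n).memLp_toFun 2).sub hf).aestronglyMeasurable,
      OffDiagStep.toFun_affine]
    rfl
  · have h3 : Tendsto (fun n => ‖√c ^ k‖ₑ *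
        eLpNorm ((φ n).integral (fun A ω => (√c)⁻¹ * W (A.affine c h hc) ω) - X) 2 P)
        atTop (𝓝 0) := by
      simpa using ENNReal.Tendsto.const_mul h2 (Or.inr (by simp))
    refine h3.congr fun n => ?_
    rw [← eLpNorm_const_smul, OffDiagStep.integral_affine, smul_sub]

end Affine

/-! ### Young's inequality and integrability of the filter -/

section Young

open scoped ENNReal

/-- A case of Young's inequality: if `f ∈ L^p` and `K ∈ L^q` with `1 / p = 1 - θ / 2` and
`1 / q = θ`, then the quadratic form with kernel `K(s - r)` is finite at `f`. -/
theorem lintegral_lintegral_mul_mul_lt_top {f K : ℝ → ℝ≥0∞} (hf : Measurable f) (hK : Measurable K)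
    {θ : ℝ} (h0 : 0 < θ) (h1 : θ ≤ 1) (hfp : ∫⁻ s, f s ^ (1 - θ / 2)⁻¹ ≠ ⊤)
    (hKq : ∫⁻ u, K u ^ θ⁻¹ ≠ ⊤) :
    ∫⁻ s, ∫⁻ r, f s * f r * K (s - r) < ⊤ := by
  have hp : 0 < 1 - θ / 2 := by linarith
  set p := (1 - θ / 2)⁻¹ with hpdef
  set q := θ⁻¹ with hqdef
  let F : Fin 3 → ℝ × ℝ → ℝ≥0∞ :=
    ![fun z => f z.1 ^ p * f z.2 ^ p, fun z => f z.1 ^ p * K (z.1 - z.2) ^ q,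
      fun z => f z.2 ^ p * K (z.1 - z.2) ^ q]
  let w : Fin 3 → ℝ := ![1 - θ, θ / 2, θ / 2]
  have hFm : ∀ i ∈ Finset.univ, AEMeasurable (F i) (volume.prod volume) := by
    intro i _
    fin_cases i <;> simp only [F] <;> exact Measurable.aemeasurable (by
      first
      | exact (hf.comp measurable_fst |>.pow_const _).mul (hf.comp measurable_snd |>.pow_const _)
      | exact (hf.comp measurable_fst |>.pow_const _).mul
          ((hK.comp (measurable_fst.sub measurable_snd)).pow_const _)
      | exact (hf.comp measurable_snd |>.pow_const _).mul
          ((hK.comp (measurable_fst.sub measurable_snd)).pow_const _))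
  have hw : ∑ i, w i = 1 := by simp [w, Fin.sum_univ_three]; ring
  have hw0 : ∀ i ∈ Finset.univ, 0 ≤ w i := by
    intro i _; fin_cases i <;> simp [w] <;> linarith
  have hH := ENNReal.lintegral_prod_norm_pow_le Finset.univ hFm hw hw0
  have hfin : ∀ i, ∫⁻ z, F i z ∂(volume.prod volume) ≠ ⊤ := by
    have hfp' : Measurable fun s => f s ^ p := hf.pow_const _
    have hKq' : Measurable fun u => K u ^ q := hK.pow_const _
    intro i
    rw [lintegral_prod _ (hFm i (Finset.mem_univ i))]
    fin_cases i
    · simp only [F]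
      simp only [Fin.zero_eta, Matrix.cons_val_zero]
      simp_rw [lintegral_const_mul _ hfp', lintegral_mul_const _ hfp']
      exact ENNReal.mul_ne_top hfp hfp
    · simp only [F]
      simp only [Fin.mk_one, Matrix.cons_val_one, Matrix.cons_val_zero]
      have e : ∀ s, ∫⁻ r, f s ^ p * K (s - r) ^ q = f s ^ p * ∫⁻ u, K u ^ q := fun s => by
        rw [lintegral_const_mul _ (by fun_prop),
          lintegral_sub_left_eq_self (fun u => K u ^ q)]
      simp_rw [e]
      rw [lintegral_mul_const _ hfp']
      exact ENNReal.mul_ne_top hfp hKq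
    · simp only [F]
      simp only [Fin.reduceFinMk, Matrix.cons_val]
      rw [lintegral_lintegral_swap (by
        exact Measurable.aemeasurable ((hf.comp measurable_snd |>.pow_const _).mul
          ((hK.comp (measurable_fst.sub measurable_snd)).pow_const _)))]
      have e : ∀ r, ∫⁻ s, f r ^ p * K (s - r) ^ q = f r ^ p * ∫⁻ u, K u ^ q := fun r => by
        rw [lintegral_const_mul _ (by fun_prop),
          lintegral_sub_right_eq_self (fun u => K u ^ q)]
      simp_rw [e]
      rw [lintegral_mul_const _ hfp']
      exact ENNReal.mul_ne_top hfp hKq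
  have hprod : ∀ z : ℝ × ℝ, ∏ i, F i z ^ w i = f z.1 * f z.2 * K (z.1 - z.2) := by
    intro z
    have e1 : p * (1 - θ) + p * (θ / 2) = 1 := by
      rw [← mul_add, show 1 - θ + θ / 2 = 1 - θ / 2 by ring, hpdef, inv_mul_cancel₀ hp.ne']
    have e2 : q * (θ / 2) + q * (θ / 2) = 1 := by
      rw [← mul_add, add_halves, hqdef, inv_mul_cancel₀ h0.ne']
    have n1 : 0 ≤ 1 - θ := by linarith
    have n2 : 0 ≤ θ / 2 := by linarith
    have hp0 : 0 ≤ p := by positivity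
    have hq0 : 0 ≤ q := by positivity
    have key : ∀ y : ℝ≥0∞, y ^ (p * (1 - θ)) * y ^ (p * (θ / 2)) = y := fun y => by
      rw [← ENNReal.rpow_add_of_nonneg _ _ (mul_nonneg hp0 n1) (mul_nonneg hp0 n2), e1,
        ENNReal.rpow_one]
    have key2 : ∀ y : ℝ≥0∞, y ^ (q * (θ / 2)) * y ^ (q * (θ / 2)) = y := fun y => by
      rw [← ENNReal.rpow_add_of_nonneg _ _ (mul_nonneg hq0 n2) (mul_nonneg hq0 n2), e2,
        ENNReal.rpow_one]
    simp only [Fin.prod_univ_three, F, w, Matrix.cons_val]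
    rw [ENNReal.mul_rpow_of_nonneg _ _ n1, ENNReal.mul_rpow_of_nonneg _ _ n2,
      ENNReal.mul_rpow_of_nonneg _ _ n2]
    simp_rw [← ENNReal.rpow_mul]
    calc _ = (f z.1 ^ (p * (1 - θ)) * f z.1 ^ (p * (θ / 2))) *
          (f z.2 ^ (p * (1 - θ)) * f z.2 ^ (p * (θ / 2))) *
          (K (z.1 - z.2) ^ (q * (θ / 2)) * K (z.1 - z.2) ^ (q * (θ / 2))) := by ring
      _ = _ := by rw [key, key, key2]
  have hm : Measurable fun z : ℝ × ℝ => f z.1 * f z.2 * K (z.1 - z.2) :=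
    ((hf.comp measurable_fst).mul (hf.comp measurable_snd)).mul
      (hK.comp (measurable_fst.sub measurable_snd))
  rw [← lintegral_prod (fun z : ℝ × ℝ => f z.1 * f z.2 * K (z.1 - z.2)) hm.aemeasurable]
  simp_rw [hprod] at hH
  refine hH.trans_lt (ENNReal.prod_lt_top fun i hi => ?_)
  exact ENNReal.rpow_lt_top_of_nonneg (hw0 i hi) (hfin i)

/-- The tempered Riesz kernel `|u| ^ γ * exp (-κ |u|)`. -/
def temperedRiesz (γ κ u : ℝ) : ℝ≥0∞ := ENNReal.ofReal (|u| ^ γ * Real.exp (-κ * |u|))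

theorem measurable_temperedRiesz (γ κ : ℝ) : Measurable (temperedRiesz γ κ) := by
  unfold temperedRiesz; fun_prop

theorem lintegral_temperedRiesz_rpow_ne_top {γ κ q : ℝ} (hκ : 0 < κ) (hq : 0 < q) (hγ : γ ≠ 0)
    (hγq : -1 < γ * q) : ∫⁻ u, temperedRiesz γ κ u ^ q ≠ ⊤ := by
  let J : ℝ → ℝ≥0∞ := (Set.Ioi 0).indicator fun u =>
    ENNReal.ofReal (u ^ (γ * q) * Real.exp (-(κ * q) * u ^ (1 : ℝ)))
  have hJ : ∫⁻ u, J u < ⊤ := by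
    rw [lintegral_indicator measurableSet_Ioi]
    exact (integrableOn_rpow_mul_exp_neg_mul_rpow hγq one_pos (mul_pos hκ hq)).lintegral_lt_top
  have hJm : Measurable J := Measurable.indicator (by fun_prop) measurableSet_Ioi
  have hpos : ∀ u : ℝ, 0 < u → temperedRiesz γ κ u ^ q = J u := by
    intro u hu
    have : J u = _ := Set.indicator_of_mem hu _
    rw [this, temperedRiesz, abs_of_pos hu,
      ENNReal.ofReal_rpow_of_nonneg (by positivity) hq.le, Real.mul_rpow (by positivity)
      (by positivity), ← Real.rpow_mul hu.le, ← Real.exp_mul, Real.rpow_one]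
    ring_nf
  have hle : ∀ u, temperedRiesz γ κ u ^ q ≤ J u + J (-u) := by
    intro u
    rcases lt_trichotomy u 0 with hu | rfl | hu
    · have : temperedRiesz γ κ u = temperedRiesz γ κ (-u) := by simp [temperedRiesz]
      rw [this, hpos (-u) (by linarith)]
      exact le_add_self
    · simp [temperedRiesz, Real.zero_rpow hγ, hq]
    · rw [hpos u hu]
      exact le_self_add
  refine ((lintegral_mono hle).trans_lt ?_).ne
  rw [lintegral_add_left hJm, lintegral_neg_eq_self J]
  exact ENNReal.add_lt_top.2 ⟨hJ, hJ⟩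

end Young

section Filter

theorem measurable_posPartPow (β : ℝ) : Measurable (posPartPow β) := by
  unfold posPartPow
  exact Measurable.ite measurableSet_Ioi (by fun_prop) measurable_const

theorem measurable_fractionalFilter (β t : ℝ) : Measurable (fractionalFilter β t) := by
  unfold fractionalFilter
  exact (((measurable_posPartPow β).comp (measurable_const.sub measurable_id)).sub
    ((measurable_posPartPow β).comp measurable_neg)).const_mul _

/-- Local `L^p` integrability; the power is cut off at its singularity `s = c`, so that no junk value
of `Real.rpow` at a negative base enters. -/
theorem memLp_posPartPow_comp_sub {β p : ℝ} (hp : 0 < p) (hβ : -1 < β * p) (c a b : ℝ) :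
    MemLp (fun s => posPartPow β (c - s)) (ENNReal.ofReal p) (volume.restrict (Set.Ioc a b)) := by
  have hm : Measurable fun s => posPartPow β (c - s) :=
    (measurable_posPartPow β).comp (measurable_const.sub measurable_id)
  rw [← integrable_norm_rpow_iff hm.aestronglyMeasurable (by simpa using hp) (by simp),
    ENNReal.toReal_ofReal hp.le]
  have h1 : IntegrableOn (fun s : ℝ => (c - s) ^ (β * p)) (Set.Ioc a b) := by
    rcases le_or_gt b a with hab | hab
    · simp [Set.Ioc_eq_empty hab.not_gt]
    have := (intervalIntegral.intervalIntegrable_rpow' (a := c - a) (b := c - b) hβ).comp_sub_left c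
    rw [intervalIntegrable_iff_integrableOn_Ioc_of_le (by simpa using hab.le)] at this
    simpa using this
  refine (h1.indicator (measurableSet_Iio (a := c))).congr (ae_of_all _ fun s => ?_)
  by_cases hs : s < c
  · have hcs : 0 < c - s := by linarith
    rw [Set.indicator_of_mem (show s ∈ Set.Iio c from hs)]
    simp only [posPartPow, if_pos hcs, Real.norm_eq_abs]
    rw [abs_of_pos (Real.rpow_pos_of_pos hcs _), ← Real.rpow_mul hcs.le]
  · have hcs : ¬ 0 < c - s := by linarith
    rw [Set.indicator_of_notMem (show s ∉ Set.Iio c from hs)]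
    simp only [posPartPow, if_neg hcs, norm_zero, Real.zero_rpow hp.ne']

/-- Far to the left the two powers in the filter nearly cancel, which gains one power of decay. -/
theorem abs_fractionalFilter_le {β t s : ℝ} (hβ : β ≠ 0) (hβ1 : β < 1) (hs : s < -|t|) :
    |fractionalFilter β t s| ≤ |t| * (-s - |t|) ^ (β - 1) := by
  have ht := neg_abs_le t
  have h1 : 0 < -s - |t| := by linarith
  have hts : 0 < t - s := by linarith
  have hs0 : 0 < -s := by linarith [abs_nonneg t]
  have hmvt := (convex_Ici (-s - |t|)).norm_image_sub_le_of_norm_hasDerivWithin_le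
    (f := fun x : ℝ => x ^ β) (f' := fun x => β * x ^ (β - 1))
    (C := |β| * (-s - |t|) ^ (β - 1)) (x := -s) (y := t - s)
    (fun x hx => (Real.hasDerivAt_rpow_const
      (Or.inl (h1.trans_le hx).ne')).hasDerivWithinAt)
    (fun x hx => by
      rw [norm_mul, Real.norm_eq_abs, Real.norm_eq_abs,
        abs_of_pos (Real.rpow_pos_of_pos (h1.trans_le hx) _)]
      exact mul_le_mul_of_nonneg_left (Real.rpow_le_rpow_of_nonpos h1 hx (by linarith))
        (abs_nonneg _))
    (Set.mem_Ici.2 (by linarith [abs_nonneg t])) (Set.mem_Ici.2 (by linarith))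
  have e : t - s - -s = t := by ring
  rw [e, Real.norm_eq_abs, Real.norm_eq_abs] at hmvt
  rw [fractionalFilter, posPartPow, posPartPow, if_pos hts, if_pos hs0, abs_mul, abs_div, abs_one]
  have hβ0 : 0 < |β| := abs_pos.2 hβ
  calc 1 / |β| * |(t - s) ^ β - (-s) ^ β|
      ≤ 1 / |β| * (|β| * (-s - |t|) ^ (β - 1) * |t|) := by gcongr
    _ = |t| * (-s - |t|) ^ (β - 1) := by field_simp

theorem lintegral_fractionalFilter_rpow_ne_top {β p : ℝ} (hβ : β ≠ 0) (hβ1 : β < 1) (hp0 : 0 < p)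
    (hlocal : -1 < β * p) (hdecay : (β - 1) * p < -1) (t : ℝ) :
    ∫⁻ s, ‖fractionalFilter β t s‖ₑ ^ p ≠ ⊤ := by
  set M := |t| + 1 with hM
  have hleft : ∫⁻ s in Set.Iic (-M), ‖fractionalFilter β t s‖ₑ ^ p < ⊤ := by
    have h1 : IntegrableOn (fun s : ℝ => (|t| * (s - |t|) ^ (β - 1)) ^ p) (Set.Ioi M) := by
      have h2 : IntegrableOn (fun s : ℝ => |t| ^ p * (s + -|t|) ^ ((β - 1) * p)) (Set.Ioi M) :=
        (integrableOn_add_rpow_Ioi_of_lt (c := M) (m := -|t|) hdecay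
          (by rw [hM]; linarith)).const_mul (|t| ^ p)
      refine h2.congr_fun (fun s hs => ?_) measurableSet_Ioi
      have hs' : 0 < s - |t| := by have : M < s := hs; linarith
      simp only
      rw [Real.mul_rpow (abs_nonneg _) (by positivity), ← Real.rpow_mul hs'.le, ← sub_eq_add_neg s]
    have h3 : ∫⁻ s in Set.Iic (-M), ENNReal.ofReal ((|t| * (-s - |t|) ^ (β - 1)) ^ p) < ⊤ := by
      have h4 : IntegrableOn (fun s : ℝ => (|t| * (-s - |t|) ^ (β - 1)) ^ p) (Set.Iio (-M)) :=
        IntegrableOn.comp_neg_Iio (c := -M) (f := fun s => (|t| * (s - |t|) ^ (β - 1)) ^ p)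
          (by rwa [neg_neg])
      rw [setLIntegral_congr Iio_ae_eq_Iic.symm]
      exact h4.lintegral_lt_top
    refine (setLIntegral_mono' measurableSet_Iic fun s hs => ?_).trans_lt h3
    have hs' : s < -|t| := by have : s ≤ -M := hs; linarith
    rw [Real.enorm_eq_ofReal_abs, ENNReal.ofReal_rpow_of_nonneg (abs_nonneg _) hp0.le]
    exact ENNReal.ofReal_le_ofReal (Real.rpow_le_rpow (abs_nonneg _)
      (abs_fractionalFilter_le hβ hβ1 hs') hp0.le)
  have hmid : ∫⁻ s in Set.Ioc (-M) M, ‖fractionalFilter β t s‖ₑ ^ p < ⊤ := by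
    have h1 := (((memLp_posPartPow_comp_sub hp0 hlocal t (-M) M).sub
      (memLp_posPartPow_comp_sub hp0 hlocal 0 (-M) M)).const_mul (1 / β))
    have h2 := lintegral_rpow_enorm_lt_top_of_eLpNorm_lt_top (by simpa using hp0) (by simp)
      h1.eLpNorm_lt_top
    rw [ENNReal.toReal_ofReal hp0.le] at h2
    simpa [fractionalFilter] using h2
  have hright : ∫⁻ s in Set.Ioi M, ‖fractionalFilter β t s‖ₑ ^ p = 0 := by
    rw [setLIntegral_congr_fun (g := fun _ => 0) measurableSet_Ioi]
    · simp
    intro s hs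
    have hs' : |t| + 1 < s := hs
    have h1 : ¬ 0 < t - s := by linarith [le_abs_self t]
    have h2 : ¬ 0 < -s := by linarith [abs_nonneg t]
    simp [fractionalFilter, posPartPow, h1, h2, hp0]
  have hM0 : -M ≤ M := by have := abs_nonneg t; linarith
  rw [← setLIntegral_univ, ← Set.Iic_union_Ioi (a := -M), ← Set.Ioc_union_Ioi_eq_Ioi hM0]
  refine ((lintegral_union_le _ _ _).trans_lt (ENNReal.add_lt_top.2 ⟨hleft, ?_⟩)).ne
  refine (lintegral_union_le _ _ _).trans_lt (ENNReal.add_lt_top.2 ⟨hmid, ?_⟩)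
  rw [hright]
  exact ENNReal.zero_lt_top

end Filter

/-! ### The filtered kernel is square integrable -/

section Kernel

open scoped ENNReal

variable {k : ℕ} {α lam μ β : ℝ} {g : (Fin k → ℝ) → ℝ}

/-- The kernel `g`, extended by zero off the positive orthant and tempered by `exp (-μ ∑ yᵢ)`. -/
def temperedKernel (g : (Fin k → ℝ) → ℝ) (μ : ℝ) (y : Fin k → ℝ) : ℝ :=
  (positiveOrthant k).indicator g y * Real.exp (-μ * ∑ i, y i)

theorem filteredIntegrand_eq (g : (Fin k → ℝ) → ℝ) (μ β t : ℝ) (x : Fin k → ℝ) (s : ℝ) :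
    filteredIntegrand g μ β t x s
      = fractionalFilter β t s * temperedKernel g μ ((fun _ => s) - x) := by
  have h : s ∈ {r : ℝ | ∀ i, x i < r} ↔ (fun _ => s) - x ∈ positiveOrthant k := by
    simp [positiveOrthant]
  rw [filteredIntegrand, temperedKernel]
  by_cases hs : s ∈ {r : ℝ | ∀ i, x i < r}
  · rw [Set.indicator_of_mem hs, Set.indicator_of_mem (h.1 hs), ← Real.exp_sum, ← Finset.mul_sum,
      mul_assoc]
    rfl
  · rw [Set.indicator_of_notMem hs, Set.indicator_of_notMem (fun h' => hs (h.2 h')), zero_mul,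
      mul_zero]

theorem measurableSet_positiveOrthant (k : ℕ) : MeasurableSet (positiveOrthant k) := by
  have : positiveOrthant k = Set.univ.pi fun _ => Set.Ioi 0 := by
    ext; simp [positiveOrthant]
  rw [this]
  exact MeasurableSet.univ_pi fun _ => measurableSet_Ioi

/-- Tonelli's theorem for the square of an integral of diagonal translates of `T`, given a bound `B`
on the overlaps of these translates. The diagonal `s = r`, where `B` need not bound anything, is
negligible. -/
theorem lintegral_sq_lintegral_le {l : ℝ → ℝ≥0∞} {T : (Fin k → ℝ) → ℝ≥0∞} (hl : Measurable l)
    (hT : Measurable T) {B : ℝ → ℝ → ℝ≥0∞}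
    (hB : ∀ s r, s ≠ r → ∫⁻ x, T ((fun _ => s) - x) * T ((fun _ => r) - x) ≤ B s r) :
    ∫⁻ x, (∫⁻ s, l s * T ((fun _ => s) - x)) ^ 2 ≤ ∫⁻ s, ∫⁻ r, l s * l r * B s r := by
  have hexp : ∀ x, (∫⁻ s, l s * T ((fun _ => s) - x)) ^ 2
      = ∫⁻ s, ∫⁻ r, l s * l r * (T ((fun _ => s) - x) * T ((fun _ => r) - x)) := by
    intro x
    have hx : Measurable fun s => l s * T ((fun _ => s) - x) := hl.mul (hT.comp (by fun_prop))
    rw [sq, ← lintegral_mul_const _ hx]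
    refine lintegral_congr fun s => ?_
    rw [← lintegral_const_mul _ hx]
    refine lintegral_congr fun r => ?_
    ring
  have hψ : Measurable fun p : ((Fin k → ℝ) × ℝ) × ℝ =>
      l p.1.2 * l p.2 * (T ((fun _ => p.1.2) - p.1.1) * T ((fun _ => p.2) - p.1.1)) :=
    ((hl.comp (by fun_prop)).mul (hl.comp (by fun_prop))).mul
      ((hT.comp (by fun_prop)).mul (hT.comp (by fun_prop)))
  simp_rw [hexp]
  rw [lintegral_lintegral_swap (Measurable.aemeasurable hψ.lintegral_prod_right')]
  refine lintegral_mono fun s => ?_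
  have hm1 : Measurable fun q : (Fin k → ℝ) × ℝ =>
      l s * l q.2 * (T ((fun _ => s) - q.1) * T ((fun _ => q.2) - q.1)) :=
    ((hl.comp measurable_snd).const_mul _).mul ((hT.comp (by fun_prop)).mul (hT.comp (by fun_prop)))
  rw [lintegral_lintegral_swap hm1.aemeasurable]
  refine lintegral_mono_ae ?_
  have hne : ∀ᵐ r : ℝ, r ≠ s := by simp [ae_iff]
  filter_upwards [hne] with r hr
  have hm3 : Measurable fun x : Fin k → ℝ => T ((fun _ => s) - x) * T ((fun _ => r) - x) :=
    (hT.comp (by fun_prop)).mul (hT.comp (by fun_prop))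
  rw [lintegral_const_mul _ hm3]
  gcongr
  exact hB s r hr.symm

namespace IsTemperedHermiteKernel

theorem measurable_indicator (hg : IsTemperedHermiteKernel k α lam g) :
    Measurable ((positiveOrthant k).indicator g) := by
  classical
  refine measurable_of_restrict_of_restrict_compl (measurableSet_positiveOrthant k) ?_ ?_
  · convert! hg.measurable using 1
    ext x
    simp
  · convert! measurable_const (a := (0 : ℝ)) using 1
    ext x
    exact Set.indicator_of_notMem x.2 g

theorem measurable_temperedKernel (hg : IsTemperedHermiteKernel k α lam g) (μ : ℝ) :
    Measurable (temperedKernel g μ) :=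
  hg.measurable_indicator.mul (by fun_prop)

theorem indicator_smul (hg : IsTemperedHermiteKernel k α lam g) {c : ℝ} (hc : 0 < c)
    (x : Fin k → ℝ) :
    (positiveOrthant k).indicator g (c • x) = c ^ α * (positiveOrthant k).indicator g x := by
  have h : c • x ∈ positiveOrthant k ↔ x ∈ positiveOrthant k := by
    simp [positiveOrthant, hc]
  by_cases hx : x ∈ positiveOrthant k
  · rw [Set.indicator_of_mem hx, Set.indicator_of_mem (h.2 hx), hg.homogeneous c hc x hx]
  · rw [Set.indicator_of_notMem hx, Set.indicator_of_notMem fun h' => hx (h.1 h'), mul_zero]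

theorem lintegral_overlap_one_lt_top (hg : IsTemperedHermiteKernel k α lam g) :
    ∫⁻ z, ‖(positiveOrthant k).indicator g z * (positiveOrthant k).indicator g (1 + z)‖ₑ < ⊤ := by
  have h := (hg.integrable 0 le_rfl).2
  simp only [mul_zero, zero_mul, Real.exp_zero, mul_one] at h
  rw [HasFiniteIntegral, ← lintegral_indicator (measurableSet_positiveOrthant k)] at h
  refine lt_of_le_of_lt (lintegral_mono fun z => ?_) h
  by_cases hz : z ∈ positiveOrthant k
  · have hz1 : 1 + z ∈ positiveOrthant k := fun i => by
      have := hz i; simp only [Pi.add_apply, Pi.one_apply]; linarith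
    simp only [Set.indicator_of_mem hz, Set.indicator_of_mem hz1]
    simp [Real.enorm_eq_ofReal_abs]
  · simp [Set.indicator_of_notMem hz]

/-- The overlap of the tempered kernel with its diagonal translate by `u`. Scaling `y = u z` turns
the integral into `u ^ (2α + k)` times the one at `u = 1`, and half of the tempering is spent on
the factor `exp (-μ k u)`. -/
theorem lintegral_overlap_le (hg : IsTemperedHermiteKernel k α lam g) (hμ : 0 < μ) {u : ℝ}
    (hu : 0 < u) :
    ∫⁻ y, ‖temperedKernel g μ y‖ₑ * ‖temperedKernel g μ (y + fun _ => u)‖ₑ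
      ≤ (∫⁻ z, ‖(positiveOrthant k).indicator g z * (positiveOrthant k).indicator g (1 + z)‖ₑ)
        * temperedRiesz (2 * α + k) (μ * k) u := by
  set G := (positiveOrthant k).indicator g with hG
  have hGm : Measurable G := hg.measurable_indicator
  have hDm : Measurable fun z : Fin k → ℝ => ‖G z * G (1 + z)‖ₑ :=
    (hGm.mul (hGm.comp (measurable_const.add measurable_id))).enorm
  have hpt : ∀ y, ‖temperedKernel g μ y‖ₑ * ‖temperedKernel g μ (y + fun _ => u)‖ₑ
      ≤ ENNReal.ofReal (u ^ (2 * α) * Real.exp (-(μ * k) * u)) *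
        ‖G (u⁻¹ • (y - 0)) * G (1 + u⁻¹ • (y - 0))‖ₑ := by
    intro y
    by_cases hy : y ∈ positiveOrthant k
    · have e1 : G y = u ^ α * G (u⁻¹ • y) := by
        rw [← hg.indicator_smul hu, smul_inv_smul₀ hu.ne']
      have e2 : G (y + fun _ => u) = u ^ α * G (1 + u⁻¹ • y) := by
        rw [← hg.indicator_smul hu, smul_add, smul_inv_smul₀ hu.ne', add_comm]
        congr 2
        ext i; simp
      have hsum : 0 ≤ ∑ i, y i := Finset.sum_nonneg fun i _ => (hy i).le
      have hu2 : u ^ (2 * α) = u ^ α * u ^ α := by rw [two_mul, Real.rpow_add hu]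
      rw [← enorm_mul, Real.enorm_eq_ofReal_abs, Real.enorm_eq_ofReal_abs,
        ← ENNReal.ofReal_mul (by positivity)]
      refine ENNReal.ofReal_le_ofReal ?_
      rw [temperedKernel, temperedKernel, ← hG, e1, e2, sub_zero]
      have e3 : ∑ i, (y + fun _ => u : Fin k → ℝ) i = ∑ i, y i + k * u := by
        simp [Finset.sum_add_distrib]
      have e4 : Real.exp (-μ * ∑ i, y i) * Real.exp (-μ * (∑ i, y i + k * u))
          ≤ Real.exp (-(μ * k) * u) := by
        rw [← Real.exp_add]
        refine Real.exp_le_exp.2 ?_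
        nlinarith [mul_nonneg hμ.le hsum]
      rw [e3]
      have e5 : u ^ α * G (u⁻¹ • y) * Real.exp (-μ * ∑ i, y i) *
          (u ^ α * G (1 + u⁻¹ • y) * Real.exp (-μ * (∑ i, y i + k * u)))
          = (u ^ α * u ^ α) * (Real.exp (-μ * ∑ i, y i) * Real.exp (-μ * (∑ i, y i + k * u))) *
            (G (u⁻¹ • y) * G (1 + u⁻¹ • y)) := by ring
      rw [e5, abs_mul, hu2, abs_of_pos (by positivity)]
      gcongr
    · have : temperedKernel g μ y = 0 := by
        rw [temperedKernel, Set.indicator_of_notMem hy, zero_mul]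
      simp [this]
  refine (lintegral_mono hpt).trans ?_
  have hDm' : Measurable fun y : Fin k → ℝ =>
      ‖G (u⁻¹ • (y - 0)) * G (1 + u⁻¹ • (y - 0))‖ₑ := hDm.comp (by fun_prop)
  rw [lintegral_const_mul _ hDm',
    ← lintegral_map (f := fun z => ‖G z * G (1 + z)‖ₑ)
      (g := fun y : Fin k → ℝ => u⁻¹ • (y - 0)) hDm (by fun_prop),
    map_volume_affine hu, lintegral_smul_measure, smul_eq_mul, ← mul_assoc, mul_comm,
    ← ENNReal.ofReal_mul (by positivity)]
  refine le_of_eq ?_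
  congr 1
  rw [temperedRiesz, abs_of_pos hu, Real.rpow_add hu, Real.rpow_natCast]
  congr 1
  ring

theorem lintegral_overlap_translates_le (hg : IsTemperedHermiteKernel k α lam g) (hμ : 0 < μ)
    {s r : ℝ} (hsr : s ≠ r) :
    ∫⁻ x, ‖temperedKernel g μ ((fun _ => s) - x)‖ₑ * ‖temperedKernel g μ ((fun _ => r) - x)‖ₑ
      ≤ (∫⁻ z, ‖(positiveOrthant k).indicator g z * (positiveOrthant k).indicator g (1 + z)‖ₑ)
        * temperedRiesz (2 * α + k) (μ * k) (s - r) := by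
  have key : ∀ s r : ℝ, s < r →
      ∫⁻ x, ‖temperedKernel g μ ((fun _ => s) - x)‖ₑ * ‖temperedKernel g μ ((fun _ => r) - x)‖ₑ
      ≤ (∫⁻ z, ‖(positiveOrthant k).indicator g z * (positiveOrthant k).indicator g (1 + z)‖ₑ)
        * temperedRiesz (2 * α + k) (μ * k) (r - s) := by
    intro s r h
    refine le_trans (le_of_eq ?_) (hg.lintegral_overlap_le hμ (sub_pos.2 h))
    rw [← lintegral_sub_left_eq_self _ (fun _ => s : Fin k → ℝ)]
    refine lintegral_congr fun x => ?_
    congr 3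
    · ext i; simp
    · ext i; simp only [Pi.sub_apply, Pi.add_apply]; ring
  rcases lt_or_gt_of_ne hsr with h | h
  · have : temperedRiesz (2 * α + k) (μ * k) (s - r) = temperedRiesz (2 * α + k) (μ * k) (r - s) := by
      simp only [temperedRiesz, abs_sub_comm s r]
    rw [this]
    exact key s r h
  · simp_rw [mul_comm ‖temperedKernel g μ ((fun _ => s) - _)‖ₑ]
    exact key r s h

/-- The square of the absolute kernel integral is integrable; this is the estimate behind the
well-definedness of the process. -/
theorem lintegral_sq_lt_top (hg : IsTemperedHermiteKernel k α lam g) (hk : 1 ≤ k) (hμ : 0 < μ)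
    (hβ_lower : -α - (k : ℝ) / 2 - 1 < β) (hβ_upper : β < -α - (k : ℝ) / 2) (hβ : β ≠ 0) (t : ℝ) :
    ∫⁻ x, (∫⁻ s, ‖filteredIntegrand g μ β t x s‖ₑ) ^ 2 < ⊤ := by
  have hα1 := hg.lt_degree
  have hα2 := hg.degree_lt
  set C := ∫⁻ z, ‖(positiveOrthant k).indicator g z * (positiveOrthant k).indicator g (1 + z)‖ₑ
    with hC
  have hCfin : C < ⊤ := hg.lintegral_overlap_one_lt_top
  have hl : Measurable fun s => ‖fractionalFilter β t s‖ₑ :=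
    (measurable_fractionalFilter β t).enorm
  have hKm := measurable_temperedRiesz (2 * α + k) (μ * k)
  simp_rw [filteredIntegrand_eq, enorm_mul]
  refine (lintegral_sq_lintegral_le hl (hg.measurable_temperedKernel μ).enorm
    fun s r hsr => hg.lintegral_overlap_translates_le hμ hsr).trans_lt ?_
  simp_rw [← hC, mul_left_comm _ C, lintegral_const_mul' C _ hCfin.ne]
  refine ENNReal.mul_lt_top hCfin ?_
  -- the exponent `θ = 1 / q` has to satisfy `-(2α + k) < θ < min 1 (2 + 2β)`
  obtain ⟨θ, hθ1, hθ2⟩ := exists_between (show -(2 * α + k) < min 1 (2 + 2 * β) from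
    lt_min (by linarith) (by linarith))
  have hθ3 := lt_min_iff.1 hθ2
  have hθ0 : 0 < θ := by linarith
  have hp : 0 < 1 - θ / 2 := by linarith [hθ3.1]
  refine lintegral_lintegral_mul_mul_lt_top hl hKm hθ0 hθ3.1.le
    (lintegral_fractionalFilter_rpow_ne_top hβ (by linarith) (inv_pos.2 hp) ?_ ?_ t)
    (lintegral_temperedRiesz_rpow_ne_top (by positivity) (inv_pos.2 hθ0) (by linarith) ?_)
  · rw [← div_eq_mul_inv, lt_div_iff₀ hp]; linarith [hθ3.2]
  · rw [← div_eq_mul_inv, div_lt_iff₀ hp]; linarith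
  · rw [← div_eq_mul_inv, lt_div_iff₀ hθ0]; linarith

theorem measurable_filteredIntegrand (hg : IsTemperedHermiteKernel k α lam g) (μ β t : ℝ) :
    Measurable fun p : (Fin k → ℝ) × ℝ => filteredIntegrand g μ β t p.1 p.2 := by
  simp_rw [filteredIntegrand_eq]
  exact ((measurable_fractionalFilter β t).comp measurable_snd).mul
    ((hg.measurable_temperedKernel μ).comp (by fun_prop))

theorem ae_integrable_filteredIntegrand (hg : IsTemperedHermiteKernel k α lam g) (hk : 1 ≤ k)
    (hμ : 0 < μ) (hβ_lower : -α - (k : ℝ) / 2 - 1 < β) (hβ_upper : β < -α - (k : ℝ) / 2)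
    (hβ : β ≠ 0) (t : ℝ) : ∀ᵐ x : Fin k → ℝ, Integrable (filteredIntegrand g μ β t x) := by
  have hm := hg.measurable_filteredIntegrand μ β t
  have h := ae_lt_top ((hm.enorm.lintegral_prod_right').pow_const 2)
    (hg.lintegral_sq_lt_top hk hμ hβ_lower hβ_upper hβ t).ne
  filter_upwards [h] with x hx
  refine ⟨(hm.comp measurable_prodMk_left).aestronglyMeasurable, ?_⟩
  exact (ENNReal.pow_lt_top_iff.1 hx).resolve_right (by norm_num)

theorem memLp_filteredKernel (hg : IsTemperedHermiteKernel k α lam g) (hk : 1 ≤ k)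
    (hμ : 0 < μ) (hβ_lower : -α - (k : ℝ) / 2 - 1 < β) (hβ_upper : β < -α - (k : ℝ) / 2)
    (hβ : β ≠ 0) (t : ℝ) : MemLp (filteredKernel g μ β t) 2 volume := by
  have hm := hg.measurable_filteredIntegrand μ β t
  refine ⟨(hm.stronglyMeasurable.integral_prod_right (ν := volume)).aestronglyMeasurable, ?_⟩
  rw [eLpNorm_lt_top_iff_lintegral_rpow_enorm_lt_top (by simp) (by simp)]
  refine lt_of_le_of_lt (lintegral_mono fun x => ?_)
    (hg.lintegral_sq_lt_top hk hμ hβ_lower hβ_upper hβ t)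
  simp only [ENNReal.toReal_ofNat, ENNReal.rpow_ofNat]
  gcongr
  exact enorm_integral_le_lintegral_enorm _

end IsTemperedHermiteKernel

end Kernel

/-! ### Translation and scaling of the kernel -/

section Transformation

variable {k : ℕ} {α lam μ β : ℝ} {g : (Fin k → ℝ) → ℝ}

theorem fractionalFilter_zero (β s : ℝ) : fractionalFilter β 0 s = 0 := by
  simp [fractionalFilter]

theorem fractionalFilter_add_sub (β t h s : ℝ) :
    fractionalFilter β (t + h) s - fractionalFilter β h s = fractionalFilter β t (s - h) := by
  simp only [fractionalFilter]
  rw [show t + h - s = t - (s - h) by ring, show h - s = -(s - h) by ring]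
  ring

theorem posPartPow_mul {c : ℝ} (hc : 0 < c) (β x : ℝ) :
    posPartPow β (c * x) = c ^ β * posPartPow β x := by
  by_cases hx : 0 < x
  · rw [posPartPow, posPartPow, if_pos hx, if_pos (mul_pos hc hx), Real.mul_rpow hc.le hx.le]
  · rw [posPartPow, posPartPow, if_neg hx, if_neg (by rwa [mul_pos_iff_of_pos_left hc]), mul_zero]

theorem fractionalFilter_mul {c : ℝ} (hc : 0 < c) (β t s : ℝ) :
    fractionalFilter β (c * t) (c * s) = c ^ β * fractionalFilter β t s := by
  rw [fractionalFilter, fractionalFilter, ← mul_sub, ← mul_neg, posPartPow_mul hc,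
    posPartPow_mul hc]
  ring

theorem filteredKernel_zero (g : (Fin k → ℝ) → ℝ) (μ β : ℝ) : filteredKernel g μ β 0 = 0 := by
  ext x
  simp [filteredKernel, filteredIntegrand_eq, fractionalFilter_zero]

/-- Translation of the kernel, wherever the integrals defining it converge. -/
theorem filteredKernel_add_sub {t h : ℝ} {x : Fin k → ℝ}
    (h1 : Integrable (filteredIntegrand g μ β (t + h) x))
    (h2 : Integrable (filteredIntegrand g μ β h x)) :
    filteredKernel g μ β (t + h) x - filteredKernel g μ β h x
      = filteredKernel g μ β t (x - fun _ => h) := by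
  rw [filteredKernel, filteredKernel, filteredKernel, ← integral_sub h1 h2,
    ← integral_sub_right_eq_self (fun s => filteredIntegrand g μ β t (x - fun _ => h) s) h]
  refine integral_congr_ae (ae_of_all _ fun s => ?_)
  simp only [filteredIntegrand_eq]
  rw [← sub_mul, fractionalFilter_add_sub]
  congr 2
  ext i
  simp

/-- Scaling of the kernel: dilating time by `c` trades the tempering parameter `μ` for `c μ`. -/
theorem IsTemperedHermiteKernel.filteredKernel_mul (hg : IsTemperedHermiteKernel k α lam g) {c : ℝ}
    (hc : 0 < c) (μ β t : ℝ) (x : Fin k → ℝ) :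
    filteredKernel g μ β (c * t) x
      = c ^ (β + α + 1) * filteredKernel g (c * μ) β t (c⁻¹ • x) := by
  have hscale : ∀ s, filteredIntegrand g μ β (c * t) x (c * s)
      = c ^ (β + α) * filteredIntegrand g (c * μ) β t (c⁻¹ • x) s := by
    intro s
    have hy : (fun _ => c * s) - x = c • ((fun _ => s) - c⁻¹ • x) := by
      ext i
      simp [mul_sub, hc.ne']
    rw [filteredIntegrand_eq, filteredIntegrand_eq, fractionalFilter_mul hc, hy, temperedKernel,
      temperedKernel, hg.indicator_smul hc, Real.rpow_add hc]
    simp only [Pi.smul_apply, smul_eq_mul, ← Finset.mul_sum]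
    rw [show -μ * (c * ∑ i, ((fun _ => s) - c⁻¹ • x : Fin k → ℝ) i)
      = -(c * μ) * ∑ i, ((fun _ => s) - c⁻¹ • x : Fin k → ℝ) i by ring]
    ring
  have hsub := Measure.integral_comp_mul_left (fun s => filteredIntegrand g μ β (c * t) x s) c
  simp_rw [hscale, integral_const_mul, abs_of_pos (inv_pos.2 hc), smul_eq_mul] at hsub
  rw [filteredKernel, filteredKernel, Real.rpow_add hc, Real.rpow_one, mul_right_comm, hsub,
    inv_mul_eq_div, div_mul_cancel₀ _ hc.ne']

end Transformation

theorem IsMultipleWienerIntegral.const_smul {k : ℕ} {Ω : Type*} [MeasurableSpace Ω] {P : Measure Ω}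
    {W : FiniteBorel → Ω → ℝ} {f : (Fin k → ℝ) → ℝ} {X : Ω → ℝ} (hW : IsWhiteNoise P W) (c : ℝ)
    (h : IsMultipleWienerIntegral P W f X) :
    IsMultipleWienerIntegral P W (c • f) (c • X) := by
  have := h.smul_add hW (c - 1) h
  rwa [sub_smul, one_smul, sub_add_cancel, sub_smul, one_smul, sub_add_cancel] at this

theorem ProbabilityTheory.IdentDistrib.congr_right_pi {Ω ι : Type*} [MeasurableSpace Ω] {P : Measure Ω} [Finite ι]
    {X Y Z : ι → Ω → ℝ} (h : IdentDistrib (fun ω t => X t ω) (fun ω t => Y t ω) P P)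
    (hYZ : ∀ t, Y t =ᵐ[P] Z t) : IdentDistrib (fun ω t => X t ω) (fun ω t => Z t ω) P P := by
  refine h.trans (IdentDistrib.of_ae_eq h.aemeasurable_snd ?_)
  filter_upwards [eventually_all.2 hYZ] with ω hω
  exact funext hω

end

theorem lemma4p2 {Ω : Type*} [MeasurableSpace Ω] (P : Measure Ω) [IsProbabilityMeasure P]
    (W : FiniteBorel → Ω → ℝ) (hW : IsWhiteNoise P W)
    (k : ℕ) (hk : 1 ≤ k) (α lam β : ℝ) (hlam : 0 < lam)
    (g : (Fin k → ℝ) → ℝ) (hg : IsTemperedHermiteKernel k α lam g)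
    (hβ_lower : -α - (k : ℝ) / 2 - 1 < β) (hβ_upper : β < -α - (k : ℝ) / 2) (hβ : β ≠ 0) :
    -- the process is well defined for every positive tempering parameter
    (∀ μ : ℝ, 0 < μ → ∀ t : ℝ,
      (∀ᵐ x : Fin k → ℝ, Integrable (filteredIntegrand g μ β t x)) ∧
      IsMultipleWienerIntegral P W (filteredKernel g μ β t) (filteredProcess P W g μ β t)) ∧
    HasStationaryIncrements P (filteredProcess P W g lam β) ∧
    ∀ c : ℝ, 0 < c →
      EqualFDD P (fun t => filteredProcess P W g lam β (c * t))
        (fun t ω => c ^ (β + 1 + α + (k : ℝ) / 2) * filteredProcess P W g (c * lam) β t ω) := by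
  have hint : ∀ μ : ℝ, 0 < μ → ∀ t : ℝ,
      ∀ᵐ x : Fin k → ℝ, Integrable (filteredIntegrand g μ β t x) := fun μ hμ t =>
    hg.ae_integrable_filteredIntegrand hk hμ hβ_lower hβ_upper hβ t
  have hL2 : ∀ μ : ℝ, 0 < μ → ∀ t : ℝ, MemLp (filteredKernel g μ β t) 2 volume := fun μ hμ t =>
    hg.memLp_filteredKernel hk hμ hβ_lower hβ_upper hβ t
  have hZ : ∀ μ : ℝ, 0 < μ → ∀ t : ℝ,
      IsMultipleWienerIntegral P W (filteredKernel g μ β t) (filteredProcess P W g μ β t) :=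
    fun μ hμ t => isMultipleWienerIntegral_multipleWienerIntegral hW (hL2 μ hμ t)
  refine ⟨fun μ hμ t => ⟨hint μ hμ t, hZ μ hμ t⟩, fun h I => ?_, fun c hc I => ?_⟩
  · -- the increments over `[h, t + h]` are the integrals of the kernel at time `t` with respect
    -- to the white noise translated by `h`
    have hW' := hW.affine one_pos h
    have hZ' := fun t : ℝ => isMultipleWienerIntegral_multipleWienerIntegral hW' (hL2 lam hlam t)
    have h0 : ∀ t : I, IsMultipleWienerIntegral P W (filteredKernel g lam β t)
        (fun ω => filteredProcess P W g lam β t ω - filteredProcess P W g lam β 0 ω) := by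
      intro t
      refine ((hZ lam hlam 0).smul_add hW (-1) (hZ lam hlam t)).congr_ae ?_ ?_
      · rw [filteredKernel_zero, smul_zero, zero_add]
      · refine ae_of_all _ fun ω => ?_
        simp only [Pi.add_apply, Pi.smul_apply, smul_eq_mul]
        ring
    refine (IdentDistrib.congr_right_pi (IsMultipleWienerIntegral.identDistrib hW hW' h0
      fun t : I => hZ' t) fun t => ?_).symm
    have h1 := (hZ lam hlam h).smul_add hW (-1) (hZ lam hlam (t + h))
    have h2 := (hZ' t).affine one_pos h
    have h3 := h2.ae_unique hW h1 (by
      filter_upwards [hint lam hlam h, hint lam hlam (t + h)] with x hx hx'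
      have := filteredKernel_add_sub hx' hx
      simp only [inv_one, one_smul, Pi.add_apply, Pi.smul_apply, smul_eq_mul]
      linarith)
    filter_upwards [h3] with ω hω
    have e : √(1 : ℝ) ^ k = 1 := by simp
    rw [Pi.smul_apply, smul_eq_mul, e, one_mul] at hω
    rw [hω, Pi.add_apply, Pi.smul_apply, smul_eq_mul]
    ring
  · -- the process at time `c t` is the integral of a multiple of the kernel at time `t` with
    -- respect to the rescaled white noise
    have hcl : 0 < c * lam := mul_pos hc hlam
    have hW' := hW.affine hc 0
    have hZ' := fun t : ℝ => isMultipleWienerIntegral_multipleWienerIntegral hW' (hL2 _ hcl t)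
    have h0 := IsMultipleWienerIntegral.identDistrib hW hW' (fun t : I => hZ (c * lam) hcl t)
      fun t : I => hZ' t
    have h1 := h0.comp (u := fun y t => c ^ (β + 1 + α + (k : ℝ) / 2) * y t) (by fun_prop)
    refine (IdentDistrib.congr_right_pi h1 fun t => ?_).symm
    have h2 := ((hZ' t).affine hc 0).const_smul hW (c ^ (β + α + 1))
    have h3 := h2.ae_unique hW (hZ lam hlam (c * t)) (ae_of_all _ fun x => by
      have hx : x - (fun _ => (0 : ℝ)) = x := sub_zero x
      rw [hg.filteredKernel_mul hc, Pi.smul_apply, smul_eq_mul, hx])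
    have hexp : c ^ (β + 1 + α + (k : ℝ) / 2) = c ^ (β + α + 1) * √c ^ k := by
      rw [Real.sqrt_eq_rpow, ← Real.rpow_natCast, ← Real.rpow_mul hc.le, ← Real.rpow_add hc]
      congr 1
      ring
    filter_upwards [h3] with ω hω
    rw [← hω, Pi.smul_apply, Pi.smul_apply, smul_eq_mul, smul_eq_mul, ← mul_assoc, ← hexp]
    rfl
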